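/- All graphs are finite and simple. A graph is $k$-connected if it has more than $k$ vertices and remains connected after the deletion of any set of fewer than $k$ vertices. Let $\omega(G)$ be the number of connected components of $G$. The toughness of $G$ is $t(G)=\min\{|X|/\omega(G-X): X\subseteq V(G),\ \omega(G-X)\ge 2\}$ if $G$ is not complete, and $t(G)=+\infty$ if $G$ is complete. A $P_{\ge 3}$-factor of $G$ is a spanning subgraph of $G$ each of whose components is a path with at least $3$ vertices. A graph $G$ is $(P_{\ge 3},n)$-factor critical avoidable if for every $W\subseteq V(G)$ with $|W|=n$ and every edge $e$ of $G-W$, the graph $G-W$ has a $P_{\ge 3}$-factor that does not contain $e$. Let $G_1+G_2$ denote the join of $G_1$ and $G_2$ (their disjoint union together with all edges between them). **Theorem.** Let $n,r\ge 0$ be integers. 1. If $G$ is an $(n+r+2)$-connected graph with $t(G)>\frac{n+r+2}{2(r+2)}$, then $G$ is $(P_{\ge 3},n)$-factor critical avoidable. 2. The toughness condition is sharp: the graph $G=K_{n+r+2}+\big((2r+3)K_1\cup K_2\big)$ is $(n+r+2)$-connected and $t(G)=\frac{n+r+2}{2(r+2)}$, but $G$ is not $(P_{\ge 3},n)$-factor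 critical avoidable. 3. The connectivity condition cannot be weakened to $(n+r+1)$-connectedness when $n\ge 1$: the graph $G=K_{n+r+1}+\big((2r+1)K_1\cup K_2\big)$ is $(n+r+1)$-connected and $t(G)=\frac{n+r+1}{2r+2}>\frac{n+r+2}{2(r+2)}$, but $G$ is not $(P_{\ge 3},n)$-factor critical avoidable. -/

import Mathlib

open scoped ENNReal

namespace PathFactor

/-- `G - X`: the graph obtained from `G` by removing the vertices in `X`. -/
abbrev deleteVerts {V : Type*} (G : SimpleGraph V) (X : Finset V) :
    SimpleGraph ((X : Set V)ᶜ : Set V) :=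
  G.induce ((X : Set V)ᶜ)

/-- `ω(G)`: the number of connected components of a finite graph. -/
noncomputable def numComponents {V : Type*} (G : SimpleGraph V) : ℕ :=
  Nat.card G.ConnectedComponent

/-- `G` is `k`-connected: it has more than `k` vertices and stays connected whenever fewer than
`k` vertices are removed. -/
def IsVertexConnected {V : Type*} [Fintype V] (G : SimpleGraph V) (k : ℕ) : Prop :=
  k < Fintype.card V ∧ ∀ X : Finset V, X.card < k → (deleteVerts G X).Connected

/-- The toughness `t(G)`: the minimum of `|X| / ω(G - X)` over the vertex subsets `X` with
`ω(G - X) ≥ 2`. If `G` is complete there is no such `X`, and the infimum is `∞`. -/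
noncomputable def toughness {V : Type*} [Fintype V] (G : SimpleGraph V) : ℝ≥0∞ :=
  ⨅ (X : Finset V) (_ : 2 ≤ numComponents (deleteVerts G X)),
    (X.card : ℝ≥0∞) / (numComponents (deleteVerts G X) : ℝ≥0∞)

/-- `F` is a `P_{≥k}`-factor of `G`: a spanning subgraph (same vertex set, `F ≤ G`) each of whose
connected components is a path with at least `k` vertices. -/
def IsPathFactor {V : Type*} (G F : SimpleGraph V) (k : ℕ) : Prop :=
  F ≤ G ∧ ∀ C : F.ConnectedComponent,
    ∃ m : ℕ, k ≤ m ∧ Nonempty (C.toSimpleGraph ≃g SimpleGraph.pathGraph m)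

/-- `G` is `P_{≥k}`-factor avoidable: for every edge `e` it has a `P_{≥k}`-factor avoiding `e`. -/
def IsPathFactorAvoidable {V : Type*} (G : SimpleGraph V) (k : ℕ) : Prop :=
  ∀ e ∈ G.edgeSet, ∃ F : SimpleGraph V, IsPathFactor G F k ∧ e ∉ F.edgeSet

/-- `G` is `(P_{≥k}, n)`-factor critical avoidable: `G - W` is `P_{≥k}`-factor avoidable for every
set `W` of exactly `n` vertices. -/
def IsPathFactorCriticalAvoidable {V : Type*} (G : SimpleGraph V) (k n : ℕ) : Prop :=
  ∀ W : Finset V, W.card = n → IsPathFactorAvoidable (deleteVerts G W) k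

/-- The join of two graphs: their disjoint union together with all edges between them. -/
def join {V W : Type*} (G : SimpleGraph V) (H : SimpleGraph W) : SimpleGraph (V ⊕ W) :=
  (G.sum H) ⊔ completeBipartiteGraph V W

/-- The join of `K_a` with the disjoint union of `b` isolated vertices and one `K_2`. -/
def extremalGraph (a b : ℕ) : SimpleGraph (Fin a ⊕ (Fin b ⊕ Fin 2)) :=
  join (⊤ : SimpleGraph (Fin a))
    ((⊥ : SimpleGraph (Fin b)).sum (⊤ : SimpleGraph (Fin 2)))

end PathFactor

/-! A sun is a single vertex or the corona of a factor-critical graph `R`: one pendant vertex is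
attached to each vertex of `R`, so `K₂` is the corona of `K₁`. The engine is Kaneko's criterion
`hasCover_of_good`: if deleting any set `S` leaves at most `2|S|` sun components, the vertices split
into paths with at least three vertices. Induced subgraphs are represented by finite sets `U` of
vertices of one fixed type, so that components, covers and edge deletions can be compared without
changing types.

Sufficiency. Let `H = G - W - e`. If `S` is empty, `H` has no sun component, because `G - W` is
2-connected with at least three vertices. If `S` is nonempty and `H - S` has more than `2|S|` suns,
then `G - (W ∪ S)` has at least `2|S|` components, since deleting one edge creates at most one
component. Connectivity forces `|S| ≥ r + 2`, and then the toughness is at most `(n + |S|) / (2|S|)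
≤ (n + r + 2) / (2(r + 2))`, a contradiction. So Kaneko's criterion applies to `H`.

Kaneko's criterion is proved by induction on the number of vertices plus edges, for a connected `U`.
If some nonempty `S` leaves exactly `2|S|` suns, Hall's theorem gives two suns to each vertex of
`S`; each such triple has a cover, and the non-sun components are covered by induction. If every
nonempty `S` leaves at most `2|S| - 2` suns, any edge can be deleted. Otherwise take a largest `S`
leaving `2|S| - 1` suns; Hall's theorem then lets any chosen vertex of `S` be the one that gets a
single sun.

If a non-sun component remains, that vertex is chosen next to it, and its sun is either large enough
for a cover of its own with the vertex or is the end of a path prolonged out of the component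
(`hasCover_pendant`). If only suns remain, failure to find a cover forces `U` to be the corona of a
graph of odd order (`hasCover_of_rest_eq_empty`, with `hasCover_of_split` excluding every other
attachment). Such a corona violates the criterion: by Tutte's theorem the core has a set `T` whose
removal leaves more than `|T|` factor-critical components, and with the `|T|` isolated pendant
vertices these give more than `2|T|` suns (`not_good_of_leaves`).

Sharpness. In the join graphs, a set that disconnects must contain the whole complete part, which
gives the toughness. After deleting `n` vertices of that part and forbidding the `K₂` edge, all `b +
2` other vertices need a neighbour among `a - n` vertices, each of degree at most two in a path
factor. -/

namespace PathFactor

set_option linter.unusedSectionVars false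

/-! ### Path covers, matchings and arms on finite vertex sets -/

section Covers

variable {V : Type*} [DecidableEq V] {G G' : SimpleGraph V}

/-- The finite vertex set can be partitioned into (vertex sets of) paths of `G` with at least three
vertices. -/
inductive HasCover (G : SimpleGraph V) : Finset V → Prop
  | empty : HasCover G ∅
  | cons {U : Finset V} (l : List V) (hc : l.IsChain G.Adj) (hn : l.Nodup) (h3 : 3 ≤ l.length)
      (hd : Disjoint l.toFinset U) (hU : HasCover G U) : HasCover G (l.toFinset ∪ U)

/-- The finite vertex set can be partitioned into pairs of adjacent vertices of `G`. -/
inductive HasMatching (G : SimpleGraph V) : Finset V → Prop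
  | empty : HasMatching G ∅
  | cons {U : Finset V} {x y : V} (h : G.Adj x y) (hx : x ∉ U) (hy : y ∉ U)
      (hU : HasMatching G U) : HasMatching G (insert x (insert y U))

theorem HasCover.mono (hG : G ≤ G') {U : Finset V} (h : HasCover G U) : HasCover G' U := by
  induction h with
  | empty => exact .empty
  | cons l hc hn h3 hd _ ih => exact .cons l (hc.imp fun _ _ h => hG h) hn h3 hd ih

theorem HasCover.union {A B : Finset V} (hA : HasCover G A) (hB : HasCover G B)
    (hd : Disjoint A B) : HasCover G (A ∪ B) := by
  induction hA with
  | empty => simpa using hB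
  | cons l hc hn h3 hdl _ ih =>
    rw [Finset.disjoint_union_left] at hd
    rw [Finset.union_assoc]
    refine .cons l hc hn h3 ?_ (ih hd.2)
    rw [Finset.disjoint_union_right]
    exact ⟨hdl, hd.1⟩

theorem HasCover.of_sdiff {A B : Finset V} (hA : HasCover G A) (hB : HasCover G (B \ A))
    (h : A ⊆ B) : HasCover G B := by
  have := hA.union hB Finset.disjoint_sdiff
  rwa [Finset.union_sdiff_of_subset h] at this

theorem HasCover.path {U : Finset V} (l : List V) (hc : l.IsChain G.Adj) (hn : l.Nodup)
    (h3 : 3 ≤ l.length) (hl : ∀ x ∈ l, x ∈ U) (hU : HasCover G (U \ l.toFinset)) :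
    HasCover G U := by
  have := HasCover.cons l hc hn h3 Finset.disjoint_sdiff hU
  rwa [Finset.union_sdiff_of_subset] at this
  intro x hx
  exact hl x (by simpa using hx)

theorem HasCover.biUnion {ι : Type*} [DecidableEq ι] (s : Finset ι) (f : ι → Finset V)
    (h : ∀ i ∈ s, HasCover G (f i))
    (hd : ∀ i ∈ s, ∀ j ∈ s, i ≠ j → Disjoint (f i) (f j)) : HasCover G (s.biUnion f) := by
  induction s using Finset.induction_on with
  | empty => exact .empty
  | insert i s hi ih =>
    rw [Finset.biUnion_insert]
    refine (h i (by simp)).union (ih (fun j hj => h j (by simp [hj]))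
      (fun j hj k hk => hd j (by simp [hj]) k (by simp [hk]))) ?_
    rw [Finset.disjoint_biUnion_right]
    intro j hj
    exact hd i (by simp) j (by simp [hj]) (by rintro rfl; exact hi hj)

theorem HasMatching.congr {U : Finset V} (h : HasMatching G U)
    (hG : ∀ x ∈ U, ∀ y ∈ U, G.Adj x y → G'.Adj x y) : HasMatching G' U := by
  induction h with
  | empty => exact .empty
  | cons h hx hy _ ih =>
    exact .cons (hG _ (by simp) _ (by simp) h) hx hy
      (ih fun a ha b hb => hG a (by simp [ha]) b (by simp [hb]))

theorem HasMatching.even {U : Finset V} (h : HasMatching G U) : Even U.card := by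
  induction h with
  | empty => simp
  | cons h hx hy _ ih =>
    rw [Finset.card_insert_of_notMem (by simp [hx, h.ne]), Finset.card_insert_of_notMem hy]
    simpa [Nat.even_add_one] using ih

theorem HasMatching.exists_partner {U : Finset V} (h : HasMatching G U) {z : V} (hz : z ∈ U) :
    ∃ w ∈ U, G.Adj z w ∧ HasMatching G (U \ {z, w}) := by
  induction h with
  | empty => simp at hz
  | @cons U x y h hx hy hU ih =>
    have hxy := h.ne
    rcases eq_or_ne z x with rfl | hzx
    · refine ⟨y, by simp, h, ?_⟩
      convert hU using 1
      ext a; simp; grind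
    rcases eq_or_ne z y with rfl | hzy
    · refine ⟨x, by simp, h.symm, ?_⟩
      convert hU using 1
      ext a; simp; grind
    have hzU : z ∈ U := by simpa [hzx, hzy] using hz
    obtain ⟨w, hw, hzw, hm⟩ := ih hzU
    refine ⟨w, by simp [hw], hzw, ?_⟩
    have := HasMatching.cons h (U := U \ {z, w}) (by simp [hx]) (by simp [hy]) hm
    convert this using 1
    ext a; simp; grind

/-- There is a path that starts at `s`, continues with at least one vertex of `C` and stays in `C`,
such that the rest of `C` has a cover. -/
def Arm (G : SimpleGraph V) (s : V) (C : Finset V) : Prop :=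
  ∃ l : List V, l ≠ [] ∧ (s :: l).IsChain G.Adj ∧ l.Nodup ∧ (∀ x ∈ l, x ∈ C) ∧
    HasCover G (C \ l.toFinset)

theorem Arm.singleton {s a : V} (h : G.Adj s a) : Arm G s {a} :=
  ⟨[a], by simp, by simpa using h, by simp, by simp, by simpa using HasCover.empty⟩

theorem Arm.pair {s z w : V} {C : Finset V} (h : G.Adj s z) (h' : G.Adj z w) (hz : z ∈ C)
    (hw : w ∈ C) (hC : HasCover G (C \ {z, w})) : Arm G s C :=
  ⟨[z, w], by simp, by simp [h, h'], by simp [h'.ne], by simp [hz, hw], by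
    convert hC using 2; ext; simp⟩

theorem Arm.cons {a t : V} {C : Finset V} (h : G.Adj a t) (ht : t ∉ C) (hC : Arm G t C) :
    Arm G a (insert t C) := by
  obtain ⟨l, h1, h2, h3, h4, h5⟩ := hC
  refine ⟨t :: l, by simp, by simpa [h] using h2, ?_, ?_, ?_⟩
  · simp only [List.nodup_cons]
    exact ⟨fun h => ht (h4 t h), h3⟩
  · intro x hx
    rcases List.mem_cons.1 hx with rfl | hx
    · simp
    · simp [h4 x hx]
  · convert h5 using 1
    ext x; simp; grind

theorem Arm.union {s : V} {C D : Finset V} (hC : Arm G s C) (hD : HasCover G D)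
    (hd : Disjoint C D) : Arm G s (C ∪ D) := by
  obtain ⟨l, h1, h2, h3, h4, h5⟩ := hC
  refine ⟨l, h1, h2, h3, fun x hx => by simp [h4 x hx], ?_⟩
  convert h5.union hD (hd.mono_left Finset.sdiff_subset) using 1
  ext x
  have : x ∈ l → x ∉ D := fun hx hx' => Finset.disjoint_left.1 hd (h4 x hx) hx'
  simp; tauto

/-- Two disjoint arms at `s` form a path through `s`. -/
theorem HasCover.of_arms {s : V} {C D : Finset V} (hC : Arm G s C) (hD : Arm G s D)
    (hd : Disjoint C D) (hsC : s ∉ C) (hsD : s ∉ D) : HasCover G (insert s (C ∪ D)) := by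
  obtain ⟨l, h1, h2, h3, h4, h5⟩ := hC
  obtain ⟨m, k1, k2, k3, k4, k5⟩ := hD
  have hdl : ∀ x ∈ l, x ∉ D := fun x hx => Finset.disjoint_left.1 hd (h4 x hx)
  have hdm : ∀ x ∈ m, x ∉ C := fun x hx hx' => Finset.disjoint_left.1 hd hx' (k4 x hx)
  have hsl : s ∉ l := fun h => hsC (h4 s h)
  have hsm : s ∉ m := fun h => hsD (k4 s h)
  refine HasCover.path (l.reverse ++ s :: m) ?_ ?_ ?_ ?_ ?_
  · rw [List.isChain_split]
    refine ⟨?_, k2⟩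
    have : l.reverse ++ [s] = (s :: l).reverse := by simp
    rw [this, List.isChain_reverse]
    exact h2.imp fun _ _ h => h.symm
  · rw [List.nodup_append]
    refine ⟨by simpa using h3, by simp [hsm, k3], ?_⟩
    intro a ha b hb hab
    subst hab
    rw [List.mem_reverse] at ha
    rcases List.mem_cons.1 hb with rfl | hb
    · exact hsl ha
    · exact hdl a ha (k4 a hb)
  · have := List.length_pos_iff.2 h1
    have := List.length_pos_iff.2 k1
    simp; omega
  · intro x hx
    simp only [List.mem_append, List.mem_reverse, List.mem_cons] at hx
    rcases hx with hx | rfl | hx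
    · simp [h4 x hx]
    · simp
    · simp [k4 x hx]
  · convert h5.union k5 (hd.mono Finset.sdiff_subset Finset.sdiff_subset) using 1
    ext x
    have := hdl x
    have := hdm x
    simp; grind

/-- Carries a cover of a vertex set back along an injection; it serves to pass from `Wᶜ` inside `V`
to the vertex type of `G - W`. -/
theorem HasCover.restrict {W : Type*} [DecidableEq W] (f : W → V) (hf : Function.Injective f)
    {U : Finset V} (h : HasCover G U) (hU : ∀ x ∈ U, ∃ w, f w = x) :
    HasCover (G.comap f) (U.preimage f hf.injOn) := by
  induction h with
  | empty => simpa using HasCover.empty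
  | @cons U l hc hn h3 hd _ ih =>
    have hU' : ∀ x ∈ U, ∃ w, f w = x := fun x hx => hU x (by simp [hx])
    have hl : ∀ x ∈ l, ∃ w, f w = x := fun x hx => hU x (by simp [hx])
    obtain ⟨m, rfl⟩ : ∃ m : List W, m.map f = l := by
      have : l ∈ Set.range (List.map f) := by
        rw [Set.range_list_map]
        exact hl
      exact this
    refine HasCover.path m ?_ ?_ (by simpa using h3) ?_ ?_
    · exact (List.isChain_map f).1 hc
    · exact hn.of_map _
    · intro x hx
      simp only [Finset.mem_preimage, Finset.mem_union, List.mem_toFinset]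
      exact Or.inl (List.mem_map_of_mem hx)
    · convert ih hU' using 1
      ext x
      have : f x ∈ List.map f m ↔ x ∈ m := by simp [hf.eq_iff]
      have h2 : f x ∈ U → x ∉ m := fun h h' =>
        Finset.disjoint_left.1 hd (by simpa using this.2 h') h
      simp only [Finset.mem_sdiff, Finset.mem_preimage, Finset.mem_union, List.mem_toFinset, this]
      tauto

end Covers

/-! ### Coronas and suns, and how paths enter them -/

section Coronas

variable {V : Type*} [DecidableEq V] {G G' : SimpleGraph V}

/-- The graph induced by `G` on `C` is the corona of the graph induced on `R`: every `v ∈ R` has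
exactly one pendant neighbour `p v`. -/
structure IsCorona (G : SimpleGraph V) (C R : Finset V) (p : V → V) : Prop where
  eq_union : C = R ∪ R.image p
  notMem : ∀ v ∈ R, p v ∉ R
  injOn : Set.InjOn p R
  adj : ∀ v ∈ R, G.Adj v (p v)
  leaf : ∀ v ∈ R, ∀ y ∈ C, G.Adj (p v) y → y = v

/-- The graph induced by `G` on `R` is nonempty and has a perfect matching after the removal of any
vertex. -/
def FactorCritical (G : SimpleGraph V) (R : Finset V) : Prop :=
  R.Nonempty ∧ ∀ v ∈ R, HasMatching G (R.erase v)

/-- `G` induces a sun on `C`: a single vertex, or the corona of a factor-critical graph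
(`K₂` being the corona of `K₁`). -/
def IsSun (G : SimpleGraph V) (C : Finset V) : Prop :=
  (∃ v, C = {v}) ∨ ∃ R p, IsCorona G C R p ∧ FactorCritical G R

theorem FactorCritical.odd {R : Finset V} (h : FactorCritical G R) : Odd R.card := by
  obtain ⟨v, hv⟩ := h.1
  have := (h.2 v hv).even
  rw [← Finset.card_erase_add_one hv]
  exact this.add_one

theorem FactorCritical.congr {R : Finset V} (h : FactorCritical G R)
    (hG : ∀ x ∈ R, ∀ y ∈ R, G.Adj x y → G'.Adj x y) : FactorCritical G' R :=
  ⟨h.1, fun v hv => (h.2 v hv).congr fun x hx y hy =>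
    hG x (Finset.mem_of_mem_erase hx) y (Finset.mem_of_mem_erase hy)⟩

namespace IsCorona

variable {C R : Finset V} {p : V → V}

theorem mem_core (h : IsCorona G C R p) {v : V} (hv : v ∈ R) : v ∈ C := by
  rw [h.eq_union]; simp [hv]

theorem mem_leaf (h : IsCorona G C R p) {v : V} (hv : v ∈ R) : p v ∈ C := by
  rw [h.eq_union]; exact Finset.mem_union_right _ (Finset.mem_image_of_mem p hv)

theorem exists_eq (h : IsCorona G C R p) {x : V} (hx : x ∈ C) : ∃ v ∈ R, x = v ∨ x = p v := by
  rw [h.eq_union, Finset.mem_union, Finset.mem_image] at hx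
  rcases hx with hx | ⟨v, hv, rfl⟩
  · exact ⟨x, hx, Or.inl rfl⟩
  · exact ⟨v, hv, Or.inr rfl⟩

theorem ne_leaf (h : IsCorona G C R p) {v w : V} (hv : v ∈ R) (hw : w ∈ R) : v ≠ p w := by
  rintro rfl
  exact h.notMem w hw hv

theorem leaf_ne (h : IsCorona G C R p) {v w : V} (hv : v ∈ R) (hw : w ∈ R) (hvw : v ≠ w) :
    p v ≠ p w := fun h' => hvw (h.injOn hv hw h')

theorem card_eq (h : IsCorona G C R p) : C.card = 2 * R.card := by
  rw [h.eq_union, Finset.card_union_of_disjoint, Finset.card_image_of_injOn h.injOn, two_mul]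
  rw [Finset.disjoint_left]
  rintro x hx hx'
  obtain ⟨v, hv, rfl⟩ := Finset.mem_image.1 hx'
  exact h.notMem v hv hx

theorem congr (h : IsCorona G C R p) (hG : ∀ x ∈ C, ∀ y ∈ C, (G.Adj x y ↔ G'.Adj x y)) :
    IsCorona G' C R p where
  eq_union := h.eq_union
  notMem := h.notMem
  injOn := h.injOn
  adj v hv := (hG _ (h.mem_core hv) _ (h.mem_leaf hv)).1 (h.adj v hv)
  leaf v hv y hy hvy := h.leaf v hv y hy ((hG _ (h.mem_leaf hv) _ hy).2 hvy)

/-- Each matching edge `xy` of the core extends by its two pendant vertices to the path `p x, x, y,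
p y`. -/
theorem hasCover_of_hasMatching (h : IsCorona G C R p) {M : Finset V} (hM : HasMatching G M)
    (hMR : M ⊆ R) : HasCover G (M ∪ M.image p) := by
  induction hM with
  | empty => simpa using HasCover.empty
  | @cons U x y hxy hx hy _ ih =>
    have hxR : x ∈ R := hMR (by simp)
    have hyR : y ∈ R := hMR (by simp)
    have hUR : U ⊆ R := fun a ha => hMR (by simp [ha])
    have hpU : ∀ v ∈ R, v ∉ U → p v ∉ U.image p := by
      intro v hv hvU hv'
      obtain ⟨u, hu, hu'⟩ := Finset.mem_image.1 hv'
      exact hvU (h.injOn (hUR hu) hv hu' ▸ hu)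
    have hpU' : ∀ v ∈ R, v ∉ U.image p := by
      intro v hv hv'
      obtain ⟨u, hu, rfl⟩ := Finset.mem_image.1 hv'
      exact h.notMem u (hUR hu) hv
    have hpU2 : ∀ v ∈ R, p v ∉ U := fun v hv hvU => h.notMem v hv (hUR hvU)
    have e : (insert x (insert y U) ∪ (insert x (insert y U)).image p) =
        [p x, x, y, p y].toFinset ∪ (U ∪ U.image p) := by
      ext a; simp; tauto
    rw [e]
    refine .cons _ ?_ ?_ (by simp) ?_ (ih hUR)
    · simp [(h.adj x hxR).symm, hxy, h.adj y hyR]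
    · have := h.ne_leaf hxR hxR
      have := h.ne_leaf hyR hxR
      have := h.ne_leaf hxR hyR
      have := h.ne_leaf hyR hyR
      have := h.leaf_ne hxR hyR hxy.ne
      have := hxy.ne
      simp; grind
    · rw [Finset.disjoint_left]
      intro a ha
      have ha : a = p x ∨ a = x ∨ a = y ∨ a = p y := by simpa using ha
      rw [Finset.mem_union, not_or]
      rcases ha with rfl | rfl | rfl | rfl
      · exact ⟨hpU2 x hxR, hpU x hxR hx⟩
      · exact ⟨hx, hpU' _ hxR⟩
      · exact ⟨hy, hpU' _ hyR⟩
      · exact ⟨hpU2 y hyR, hpU y hyR hy⟩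

theorem hasCover_sdiff (h : IsCorona G C R p) {T : Finset V} (hT : T ⊆ R)
    (hM : HasMatching G (R \ T)) : HasCover G (C \ (T ∪ T.image p)) := by
  convert h.hasCover_of_hasMatching hM Finset.sdiff_subset using 1
  ext a
  rw [h.eq_union]
  simp only [Finset.mem_sdiff, Finset.mem_union, Finset.mem_image, not_or, not_exists, not_and]
  constructor
  · rintro ⟨ha | ⟨v, hv, rfl⟩, h1, h2⟩
    · exact Or.inl ⟨ha, h1⟩
    · exact Or.inr ⟨v, ⟨hv, fun hvT => h2 v hvT rfl⟩, rfl⟩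
  · rintro (⟨ha, h1⟩ | ⟨v, ⟨hv, hvT⟩, rfl⟩)
    · exact ⟨Or.inl ha, h1, fun v hv hva => h.notMem v (hT hv) (hva ▸ ha)⟩
    · exact ⟨Or.inr ⟨v, hv, rfl⟩, fun hpT => h.notMem v hv (hT hpT),
        fun w hw hwv => hvT (h.injOn (hT hw) hv hwv ▸ hw)⟩

theorem hasCover_sdiff_pair (h : IsCorona G C R p) (hR : FactorCritical G R) {v : V} (hv : v ∈ R) :
    HasCover G (C \ {v, p v}) := by
  have := h.hasCover_sdiff (T := {v}) (by simpa using hv)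
    (by rw [Finset.sdiff_singleton_eq_erase]; exact hR.2 v hv)
  convert this using 2
  ext; simp

theorem exists_partner (h : IsCorona G C R p) (hR : FactorCritical G R) {z : V} (hz : z ∈ C) :
    ∃ w ∈ C, G.Adj z w ∧ HasCover G (C \ {z, w}) := by
  obtain ⟨v, hv, rfl | rfl⟩ := h.exists_eq hz
  · exact ⟨p z, h.mem_leaf hv, h.adj z hv, h.hasCover_sdiff_pair hR hv⟩
  · refine ⟨v, h.mem_core hv, (h.adj v hv).symm, ?_⟩
    rw [Finset.pair_comm]
    exact h.hasCover_sdiff_pair hR hv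

theorem exists_core_edge (hR : FactorCritical G R) {v z : V} (hv : v ∈ R) (hz : z ∈ R)
    (hzv : z ≠ v) : ∃ w ∈ R, w ≠ v ∧ w ≠ z ∧ G.Adj z w ∧ HasMatching G (R \ {v, z, w}) := by
  obtain ⟨w, hw, hzw, hm⟩ := (hR.2 v hv).exists_partner (z := z) (by simp [hz, hzv])
  rw [Finset.mem_erase] at hw
  refine ⟨w, hw.2, hw.1, hzw.ne.symm, hzw, ?_⟩
  convert hm using 1
  ext a; simp; tauto

/-- Two near-perfect matchings combine: one missing `v` pairs `z` with `w`, and one missing `w`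
pairs `z` with some `u ≠ w`. The path `p w, w, z, u, p u` uses `z` without its pendant vertex, and
the rest of the core is still perfectly matched. -/
theorem hasCover_erase_leaf (h : IsCorona G C R p) (hR : FactorCritical G R) {z : V} (hz : z ∈ R)
    (h2 : 2 ≤ R.card) : HasCover G (C.erase (p z)) := by
  obtain ⟨v, hv, hvz⟩ := Finset.exists_mem_ne h2 z
  obtain ⟨w, hw, -, hwz, hzw, -⟩ := exists_core_edge hR hv hz hvz.symm
  obtain ⟨u, hu, huw, huz, hzu, hm⟩ := exists_core_edge hR hw hz hwz.symm
  have hc := h.hasCover_sdiff (T := {w, z, u})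
    (by intro a; simp; rintro (rfl | rfl | rfl) <;> assumption) hm
  have hA : Arm G z {w, p w} :=
    Arm.pair hzw (h.adj w hw) (by simp) (by simp) (by simpa using HasCover.empty)
  have hB : Arm G z {u, p u} :=
    Arm.pair hzu (h.adj u hu) (by simp) (by simp) (by simpa using HasCover.empty)
  have n1 := h.leaf_ne hw hu huw.symm
  have n2 := h.ne_leaf hw hu
  have n3 := h.ne_leaf hu hw
  have n4 := h.ne_leaf hz hu
  have n5 := h.ne_leaf hz hw
  have n6 := h.ne_leaf hz hz
  have n7 := h.leaf_ne hw hz hwz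
  have n8 := h.leaf_ne hu hz huz
  have n9 := h.ne_leaf hu hz
  have n10 := h.ne_leaf hw hz
  have hP := HasCover.of_arms hA hB
    (by rw [Finset.disjoint_left]; intro a; simp; grind) (by simp; grind) (by simp; grind)
  refine hP.of_sdiff ?_ ?_
  · convert hc using 1
    ext a; simp; grind
  · have := h.mem_core hz
    have := h.mem_core hw
    have := h.mem_core hu
    have := h.mem_leaf hw
    have := h.mem_leaf hu
    intro a; simp; grind

end IsCorona

/-- Two arms entering a corona at a pendant vertex and at another vertex. -/
theorem IsCorona.hasCover_of_arms {C R : Finset V} {p : V → V} (h : IsCorona G C R p)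
    (hR : FactorCritical G R) {z x s t : V} {X Y : Finset V} (hz : z ∈ R) (hx : x ∈ C)
    (hxz : x ≠ p z) (hsz : G.Adj s (p z)) (htx : G.Adj t x) (hst : s ≠ t)
    (hsC : s ∉ C) (htC : t ∉ C) (hX : Arm G s X) (hY : Arm G t Y)
    (hsX : s ∉ X) (htX : t ∉ X) (hsY : s ∉ Y) (htY : t ∉ Y) (hXY : Disjoint X Y)
    (hXC : Disjoint X C) (hYC : Disjoint Y C) :
    HasCover G (insert s (insert t (X ∪ Y ∪ C))) := by
  rw [Finset.disjoint_left] at hXY hXC hYC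
  have hzC := h.mem_core hz
  have hpzC := h.mem_leaf hz
  have n1 := h.ne_leaf hz hz
  obtain ⟨v, hv, hxv⟩ := h.exists_eq hx
  -- If `x` belongs to the same pendant pair as `p z`, then `x = z` and a single path runs `X, s, p
  -- z, z, t, Y`. Otherwise the near-perfect matching missing `v` pairs `z` with `w`; the arm at `s`
  -- is prolonged by `p z, z, w, p w` and the arm at `t` by the pair `v, p v`.
  by_cases hvz : v = z
  · subst hvz
    obtain rfl : x = v := by tauto
    have a1 : Arm G x (insert t Y) := hY.cons htx.symm htY
    have a2 : Arm G (p x) (insert x (insert t Y)) :=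
      a1.cons (h.adj x hz).symm (by simp; grind)
    have a3 := a2.cons hsz (by simp; grind)
    have a4 := a3.union (h.hasCover_sdiff_pair hR hz)
      (by rw [Finset.disjoint_left]; intro a; simp; grind)
    have := HasCover.of_arms hX a4 (by rw [Finset.disjoint_left]; intro a; simp; grind)
      hsX (by simp; grind)
    convert this using 1
    ext a; simp; grind
  · obtain ⟨w, hw, hwv, hwz, hzw, hm⟩ := exists_core_edge hR hv hz (Ne.symm hvz)
    have hc := h.hasCover_sdiff (T := {v, z, w})
      (by intro a; simp; rintro (rfl | rfl | rfl) <;> assumption) hm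
    have hA : Arm G z {w, p w} :=
      Arm.pair hzw (h.adj w hw) (by simp) (by simp) (by simpa using HasCover.empty)
    have k1 := h.leaf_ne hw hz hwz
    have k2 := h.leaf_ne hw hv hwv
    have k3 := h.leaf_ne hv hz hvz
    have k4 := h.ne_leaf hv hz
    have k5 := h.ne_leaf hv hw
    have k6 := h.ne_leaf hz hv
    have k7 := h.ne_leaf hz hw
    have k8 := h.ne_leaf hw hv
    have k9 := h.ne_leaf hw hz
    have hvC := h.mem_core hv
    have hwC := h.mem_core hw
    have hpvC := h.mem_leaf hv
    have hpwC := h.mem_leaf hw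
    have a2 : Arm G (p z) (insert z {w, p w}) := hA.cons (h.adj z hz).symm (by simp; grind)
    have a3 := a2.cons hsz (by simp; grind)
    have c1 := HasCover.of_arms hX a3 (by rw [Finset.disjoint_left]; intro a; simp; grind)
      hsX (by simp; grind)
    have b1 : Arm G t {v, p v} := by
      rcases hxv with rfl | rfl
      · exact Arm.pair htx (h.adj x hv) (by simp) (by simp) (by simpa using HasCover.empty)
      · exact Arm.pair htx (h.adj v hv).symm (by simp) (by simp)
          (by rw [Finset.pair_comm]; simpa using HasCover.empty)
    have c2 := HasCover.of_arms hY b1 (by rw [Finset.disjoint_left]; intro a; simp; grind)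
      htY (by simp; grind)
    have c3 := (c1.union c2 (by rw [Finset.disjoint_left]; intro a; simp; grind)).union hc
      (by rw [Finset.disjoint_left]; intro a; simp; grind)
    convert c3 using 1
    ext a; simp; grind

/-- Two arms meeting at a vertex `z` such that the rest of `C` has a cover. -/
theorem hasCover_of_arms_through {C X Y : Finset V} {s t z : V} (hz : z ∈ C)
    (hsz : G.Adj s z) (htz : G.Adj t z) (hst : s ≠ t) (hsC : s ∉ C) (htC : t ∉ C)
    (hX : Arm G s X) (hY : Arm G t Y) (hsX : s ∉ X) (htX : t ∉ X) (hsY : s ∉ Y) (htY : t ∉ Y)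
    (hXY : Disjoint X Y) (hXC : Disjoint X C) (hYC : Disjoint Y C) (hC : HasCover G (C.erase z)) :
    HasCover G (insert s (insert t (X ∪ Y ∪ C))) := by
  rw [Finset.disjoint_left] at hXY hXC hYC
  have a1 := hX.cons hsz.symm hsX
  have a2 := hY.cons htz.symm htY
  have c1 := HasCover.of_arms a1 a2 (by rw [Finset.disjoint_left]; intro a; simp; grind)
    (by simp; grind) (by simp; grind)
  have c2 := c1.union hC (by rw [Finset.disjoint_left]; intro a; simp; grind)
  convert c2 using 1
  ext a; simp; grind

namespace IsSun

variable {C : Finset V}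

theorem congr (h : IsSun G C) (hG : ∀ x ∈ C, ∀ y ∈ C, (G.Adj x y ↔ G'.Adj x y)) :
    IsSun G' C := by
  rcases h with h | ⟨R, p, h, hR⟩
  · exact Or.inl h
  · exact Or.inr ⟨R, p, h.congr hG, hR.congr fun x hx y hy =>
      (hG x (h.mem_core hx) y (h.mem_core hy)).1⟩

theorem exists_partner (h : IsSun G C) (h2 : 2 ≤ C.card) {z : V} (hz : z ∈ C) :
    ∃ w ∈ C, G.Adj z w ∧ HasCover G (C \ {z, w}) := by
  rcases h with ⟨v, rfl⟩ | ⟨R, p, h, hR⟩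
  · simp at h2
  · exact h.exists_partner hR hz

theorem arm (h : IsSun G C) {s z : V} (hz : z ∈ C) (hsz : G.Adj s z) : Arm G s C := by
  rcases h with ⟨v, rfl⟩ | ⟨R, p, h, hR⟩
  · obtain rfl : z = v := by simpa using hz
    exact Arm.singleton hsz
  · obtain ⟨w, hw, hzw, hc⟩ := h.exists_partner hR hz
    exact Arm.pair hsz hzw hz hw hc

theorem hasCover_insert (h : IsSun G C) (h2 : 2 ≤ C.card) {s z : V} (hz : z ∈ C)
    (hsz : G.Adj s z) (hs : s ∉ C) : HasCover G (insert s C) := by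
  obtain ⟨w, hw, hzw, hc⟩ := h.exists_partner h2 hz
  have hzw' := hzw.ne
  have c := HasCover.of_arms (Arm.singleton hsz.symm) (Arm.singleton hzw)
    (by simp; rintro rfl; exact hs hw) (by simpa using hsz.ne.symm) (by simpa using hzw.ne)
  refine c.of_sdiff ?_ ?_
  · convert hc using 1
    ext a; simp; grind
  · intro a; simp; grind

/-- A sun with at least three vertices has a pendant vertex outside any given pair. -/
theorem exists_leaf (h : IsSun G C) (h3 : 3 ≤ C.card) (x y : V) :
    ∃ l ∈ C, ∃ m ∈ C, l ≠ x ∧ l ≠ y ∧ l ≠ m ∧ ∀ w ∈ C, G.Adj l w → w = m := by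
  rcases h with ⟨v, rfl⟩ | ⟨R, p, h, hR⟩
  · simp at h3
  · have hc := h.card_eq
    -- The core has odd order and `2|R| ≥ 3`, hence `|R| ≥ 3`: there are more pendant vertices than
    -- the two to be avoided.
    obtain ⟨k, hk⟩ := hR.odd
    have hcard : ({x, y} : Finset V).card < (R.image p).card := by
      rw [Finset.card_image_of_injOn h.injOn]
      have := Finset.card_le_two (a := x) (b := y)
      omega
    obtain ⟨l, hl, hl'⟩ := Finset.exists_mem_notMem_of_card_lt_card hcard
    obtain ⟨v, hv, rfl⟩ := Finset.mem_image.1 hl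
    simp at hl'
    exact ⟨p v, h.mem_leaf hv, v, h.mem_core hv, hl'.1, hl'.2, (h.ne_leaf hv hv).symm, h.leaf v hv⟩

end IsSun

end Coronas

/-! ### Components as vertex sets, and their correspondence with connected components -/

section Components

variable {V : Type*} [DecidableEq V] {G G' : SimpleGraph V}

/-- No edge of `G` leads from `C` to `U \ C`. -/
def Closed (G : SimpleGraph V) (U C : Finset V) : Prop :=
  ∀ x ∈ C, ∀ y ∈ U, G.Adj x y → y ∈ C

/-- The graph induced by `G` on `C` is connected. -/
def Conn (G : SimpleGraph V) (C : Finset V) : Prop :=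
  C.Nonempty ∧ ∀ D ⊆ C, D.Nonempty → Closed G C D → D = C

open scoped Classical in
/-- The vertex sets of the connected components of the graph induced by `G` on `U`. -/
noncomputable def comps (G : SimpleGraph V) (U : Finset V) : Finset (Finset V) :=
  U.powerset.filter fun C => Conn G C ∧ Closed G U C

open scoped Classical in
/-- The vertex sets of the components of the graph induced by `G` on `U` that are suns. -/
noncomputable def suns (G : SimpleGraph V) (U : Finset V) : Finset (Finset V) :=
  (comps G U).filter (IsSun G)

theorem mem_comps {U C : Finset V} : C ∈ comps G U ↔ C ⊆ U ∧ Conn G C ∧ Closed G U C := by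
  simp [comps]

theorem mem_suns {U C : Finset V} : C ∈ suns G U ↔ C ∈ comps G U ∧ IsSun G C := by
  simp [suns]

theorem suns_subset_comps {U : Finset V} : suns G U ⊆ comps G U := by
  classical exact Finset.filter_subset _ _

theorem Closed.mono {U U' C : Finset V} (h : Closed G U C) (hU : U' ⊆ U) : Closed G U' C :=
  fun x hx y hy => h x hx y (hU hy)

theorem Closed.sdiff {U C : Finset V} (h : Closed G U C) : Closed G U (U \ C) := by
  intro x hx y hy hxy
  rw [Finset.mem_sdiff] at hx ⊢
  exact ⟨hy, fun hyC => hx.2 (h y hyC x hx.1 hxy.symm)⟩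

theorem Conn.congr {C : Finset V} (h : Conn G C)
    (hG : ∀ x ∈ C, ∀ y ∈ C, (G.Adj x y ↔ G'.Adj x y)) : Conn G' C :=
  ⟨h.1, fun D hD hD0 hcl => h.2 D hD hD0 fun x hx y hy hxy =>
    hcl x hx y hy ((hG x (hD hx) y hy).1 hxy)⟩

theorem Conn.singleton (v : V) : Conn G {v} := by
  refine ⟨by simp, fun D hD hD0 _ => ?_⟩
  rcases Finset.subset_singleton_iff.1 hD with rfl | h
  · simp at hD0
  · exact h

theorem Conn.subset_of_closed {U C D : Finset V} (h : Conn G C) (hCU : C ⊆ U)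
    (hD : Closed G U D) (hCD : (C ∩ D).Nonempty) : C ⊆ D := by
  have := h.2 (C ∩ D) Finset.inter_subset_left hCD (by
    intro x hx y hy hxy
    rw [Finset.mem_inter] at hx ⊢
    exact ⟨hy, hD x hx.2 y (hCU hy) hxy⟩)
  rw [← this]
  exact Finset.inter_subset_right

theorem comps_eq {U C D : Finset V} (hC : C ∈ comps G U) (hD : D ∈ comps G U) {x : V}
    (hxC : x ∈ C) (hxD : x ∈ D) : C = D := by
  rw [mem_comps] at hC hD
  apply Finset.Subset.antisymm
  · exact hC.2.1.subset_of_closed hC.1 hD.2.2 ⟨x, by simp [hxC, hxD]⟩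
  · exact hD.2.1.subset_of_closed hD.1 hC.2.2 ⟨x, by simp [hxC, hxD]⟩

theorem comps_disjoint {U C D : Finset V} (hC : C ∈ comps G U) (hD : D ∈ comps G U)
    (hCD : C ≠ D) : Disjoint C D := by
  rw [Finset.disjoint_left]
  intro x hx hx'
  exact hCD (comps_eq hC hD hx hx')

/-- A minimal closed set containing `x` is connected: if a closed part misses `x`, its complement in
the set is closed and contains `x`, so by minimality it is everything. -/
theorem exists_mem_comps {U : Finset V} {x : V} (hx : x ∈ U) : ∃ C ∈ comps G U, x ∈ C := by
  classical
  obtain ⟨C, hC⟩ := Finset.exists_minimal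
    (s := U.powerset.filter fun C => x ∈ C ∧ Closed G U C)
    ⟨U, by simp only [Finset.mem_filter, Finset.mem_powerset, Finset.Subset.refl, hx, true_and]
           exact fun _ _ y hy _ => hy⟩
  have hC1 := hC.prop
  simp only [Finset.mem_filter, Finset.mem_powerset] at hC1
  obtain ⟨hCU, hxC, hcl⟩ := hC1
  have key : ∀ D ⊆ C, x ∈ D → Closed G C D → D = C := by
    intro D hD hxD hDcl
    apply Finset.Subset.antisymm hD
    refine hC.le_of_le ?_ hD
    simp only [Finset.mem_filter, Finset.mem_powerset]
    refine ⟨hD.trans hCU, hxD, fun a ha y hy hay => ?_⟩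
    exact hDcl a ha y (hcl a (hD ha) y hy hay) hay
  refine ⟨C, mem_comps.2 ⟨hCU, ⟨⟨x, hxC⟩, ?_⟩, hcl⟩, hxC⟩
  intro D hD hD0 hDcl
  by_cases hxD : x ∈ D
  · exact key D hD hxD hDcl
  · have := key (C \ D) Finset.sdiff_subset (by simp [hxC, hxD]) hDcl.sdiff
    obtain ⟨d, hd⟩ := hD0
    have hdC := hD hd
    rw [← this] at hdC
    simp [hd] at hdC

theorem biUnion_comps (U : Finset V) : (comps G U).biUnion id = U := by
  ext x
  simp only [Finset.mem_biUnion, id]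
  constructor
  · rintro ⟨C, hC, hx⟩
    exact (mem_comps.1 hC).1 hx
  · intro hx
    obtain ⟨C, hC, hx⟩ := exists_mem_comps (G := G) hx
    exact ⟨C, hC, hx⟩

theorem sum_card_comps (U : Finset V) : ∑ C ∈ comps G U, C.card = U.card := by
  conv_rhs => rw [← biUnion_comps (G := G) U]
  rw [Finset.card_biUnion]
  · rfl
  · intro C hC D hD h
    exact comps_disjoint hC hD h

/-- A component remains a component in every vertex set in which it is closed. -/
theorem comps_transfer {U U' C : Finset V} (h : C ∈ comps G U) (hC : C ⊆ U')
    (hcl : Closed G U' C) : C ∈ comps G U' := by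
  rw [mem_comps] at h ⊢
  exact ⟨hC, h.2.1, hcl⟩

theorem suns_transfer {U U' C : Finset V} (h : C ∈ suns G U) (hC : C ⊆ U')
    (hcl : Closed G U' C) : C ∈ suns G U' := by
  rw [mem_suns] at h ⊢
  exact ⟨comps_transfer h.1 hC hcl, h.2⟩

/-- Only edges with an end in `C` decide whether `C` is a component, so components away from a
deleted edge are unaffected. -/
theorem comps_congr {U C : Finset V} (h : C ∈ comps G U)
    (hG : ∀ x ∈ C, ∀ y ∈ U, (G.Adj x y ↔ G'.Adj x y)) : C ∈ comps G' U := by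
  rw [mem_comps] at h ⊢
  exact ⟨h.1, h.2.1.congr fun x hx y hy => hG x hx y (h.1 hy),
    fun x hx y hy hxy => h.2.2 x hx y hy ((hG x hx y hy).2 hxy)⟩

theorem suns_congr {U C : Finset V} (h : C ∈ suns G U)
    (hG : ∀ x ∈ C, ∀ y ∈ U, (G.Adj x y ↔ G'.Adj x y)) : C ∈ suns G' U := by
  rw [mem_suns] at h ⊢
  have hCU := (mem_comps.1 h.1).1
  exact ⟨comps_congr h.1 hG, h.2.congr fun x hx y hy => hG x hx y (hCU hy)⟩

theorem singleton_mem_suns {U : Finset V} {v : V} (hv : v ∈ U)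
    (h : ∀ y ∈ U, ¬ G.Adj v y) : {v} ∈ suns G U := by
  rw [mem_suns, mem_comps]
  refine ⟨⟨by simpa using hv, Conn.singleton v, ?_⟩, Or.inl ⟨v, rfl⟩⟩
  intro x hx y hy hxy
  obtain rfl : x = v := by simpa using hx
  exact absurd hxy (h y hy)

/-- A connected set containing a proper nonempty part has an edge leaving the part. -/
theorem Conn.exists_adj {U D : Finset V} (h : Conn G U) (hD : D ⊆ U) (hD0 : D.Nonempty)
    (hDU : D ≠ U) : ∃ x ∈ D, ∃ y ∈ U, y ∉ D ∧ G.Adj x y := by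
  by_contra hcon
  push Not at hcon
  refine hDU (h.2 D hD hD0 fun x hx y hy hxy => ?_)
  by_contra hyD
  exact hcon x hx y hy hyD hxy

section Transport

variable {W : Type*} [Fintype W]

open scoped Classical in
/-- The connected components of `H` correspond to the members of `comps G B` whenever `H` is
isomorphic to the graph induced by `G` on `B`. -/
theorem exists_component_equiv (H : SimpleGraph W) (g : W → V) (hg : Function.Injective g)
    (hadj : ∀ a b, H.Adj a b ↔ G.Adj (g a) (g b)) (B : Finset V)
    (hB : ∀ x, x ∈ B ↔ ∃ w, g w = x) :
    ∃ Φ : H.ConnectedComponent ≃ {C // C ∈ comps G B},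
      ∀ c, (Φ c : Finset V) = (Finset.univ.filter fun w => w ∈ c.supp).image g := by
  have hmem : ∀ c : H.ConnectedComponent,
      (Finset.univ.filter fun w => w ∈ c.supp).image g ∈ comps G B := by
    intro c
    rw [mem_comps]
    refine ⟨?_, ⟨?_, ?_⟩, ?_⟩
    · intro x hx
      obtain ⟨w, -, rfl⟩ := Finset.mem_image.1 hx
      exact (hB _).2 ⟨w, rfl⟩
    · obtain ⟨w, hw⟩ := c.nonempty_supp
      exact ⟨g w, Finset.mem_image_of_mem _ (by simpa using hw)⟩
    · intro D hD hD0 hcl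
      apply Finset.Subset.antisymm hD
      obtain ⟨x, hx⟩ := hD0
      obtain ⟨w, hw, rfl⟩ := Finset.mem_image.1 (hD hx)
      intro y hy
      obtain ⟨u, hu, rfl⟩ := Finset.mem_image.1 hy
      have hwc : w ∈ c.supp := by simpa using hw
      have huc : u ∈ c.supp := by simpa using hu
      have hr : H.Reachable w u := by
        rw [SimpleGraph.ConnectedComponent.mem_supp_iff] at hwc huc
        exact SimpleGraph.ConnectedComponent.exact (hwc.trans huc.symm)
      obtain ⟨q⟩ := hr
      clear hy hu huc hw
      induction q with
      | nil => exact hx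
      | @cons a b d hab q ih =>
        have hb : b ∈ c.supp := (c.mem_supp_congr_adj hab).1 hwc
        refine ih ?_ hb
        refine hcl _ hx _ (Finset.mem_image_of_mem _ (by simpa using hb)) ((hadj _ _).1 hab)
    · intro x hx y hy hxy
      obtain ⟨w, hw, rfl⟩ := Finset.mem_image.1 hx
      obtain ⟨u, rfl⟩ := (hB y).1 hy
      refine Finset.mem_image_of_mem _ ?_
      have hwc : w ∈ c.supp := by simpa using hw
      simpa using (c.mem_supp_congr_adj ((hadj _ _).2 hxy)).1 hwc
  refine ⟨Equiv.ofBijective (fun c => ⟨_, hmem c⟩) ⟨?_, ?_⟩, fun c => rfl⟩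
  · intro c d hcd
    have hcd := congrArg Subtype.val hcd
    obtain ⟨w, hw⟩ := c.nonempty_supp
    have : g w ∈ (Finset.univ.filter fun w => w ∈ c.supp).image g :=
      Finset.mem_image_of_mem _ (by simpa using hw)
    have hcd : (Finset.univ.filter fun w => w ∈ c.supp).image g =
      (Finset.univ.filter fun w => w ∈ d.supp).image g := hcd
    rw [hcd] at this
    obtain ⟨u, hu, huw⟩ := Finset.mem_image.1 this
    obtain rfl := hg huw
    have hu : u ∈ d.supp := by simpa using hu
    rw [SimpleGraph.ConnectedComponent.mem_supp_iff] at hw hu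
    exact hw.symm.trans hu
  · rintro ⟨C, hC⟩
    have hC' := mem_comps.1 hC
    obtain ⟨x, hx⟩ := hC'.2.1.1
    obtain ⟨w, rfl⟩ := (hB x).1 (hC'.1 hx)
    refine ⟨H.connectedComponentMk w, Subtype.ext ?_⟩
    refine comps_eq (hmem _) hC (Finset.mem_image_of_mem _ ?_) hx
    simp

end Transport

end Components

/-! ### Tutte's theorem and factor-critical components -/

section Tutte

variable {V : Type*} [DecidableEq V] {G : SimpleGraph V}

theorem hasMatching_of_involution (f : V → V) (A : Finset V)
    (h : ∀ x ∈ A, f x ∈ A ∧ f (f x) = x ∧ G.Adj x (f x)) : HasMatching G A := by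
  induction hn : A.card using Nat.strong_induction_on generalizing A with
  | _ n ih =>
    subst hn
    rcases A.eq_empty_or_nonempty with rfl | ⟨x, hx⟩
    · exact .empty
    obtain ⟨h1, h2, h3⟩ := h x hx
    have hss : A \ {x, f x} ⊂ A :=
      Finset.ssubset_iff_subset_ne.2 ⟨Finset.sdiff_subset, fun he => by
        rw [← he] at hx; simp at hx⟩
    have := ih _ (Finset.card_lt_card hss) (A \ {x, f x}) (fun y hy => by
      simp only [Finset.mem_sdiff, Finset.mem_insert, Finset.mem_singleton, not_or] at hy ⊢
      obtain ⟨k1, k2, k3⟩ := h y hy.1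
      refine ⟨⟨k1, fun e => hy.2.2 ?_, fun e => hy.2.1 ?_⟩, k2, k3⟩
      · rw [← k2, e]
      · rw [← k2, e, h2]) rfl
    have := HasMatching.cons h3 (by simp) (by simp) this
    convert this using 1
    ext y; simp; grind

open scoped Classical in
/-- The components of odd order of the graph induced on `U`. -/
noncomputable def oddComps (G : SimpleGraph V) (U : Finset V) : Finset (Finset V) :=
  (comps G U).filter fun C => Odd C.card

theorem mem_oddComps {U C : Finset V} : C ∈ oddComps G U ↔ C ∈ comps G U ∧ Odd C.card := by
  simp [oddComps]

theorem odd_card_oddComps (U : Finset V) : Odd (oddComps G U).card ↔ Odd U.card := by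
  classical
  rw [← sum_card_comps (G := G) U, Finset.odd_sum_iff_odd_card_odd, oddComps]

/-- Tutte's theorem on the induced graph, with a Tutte violator translated into a finite subset of
`A`. -/
theorem exists_lt_card_oddComps {A : Finset V} (h : ¬ HasMatching G A) :
    ∃ T ⊆ A, T.card < (oddComps G (A \ T)).card := by
  classical
  set H : SimpleGraph {x // x ∈ A} := G.comap Subtype.val with hH
  by_cases hM : ∃ M : H.Subgraph, M.IsPerfectMatching
  · exfalso
    obtain ⟨M, hM⟩ := hM
    rw [SimpleGraph.Subgraph.isPerfectMatching_iff] at hM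
    choose f hf hf' using hM
    refine h (hasMatching_of_involution (fun x => if hx : x ∈ A then (f ⟨x, hx⟩ : V) else x) A ?_)
    intro x hx
    simp only [hx, dif_pos]
    refine ⟨(f ⟨x, hx⟩).2, ?_, ?_⟩
    · rw [dif_pos (f ⟨x, hx⟩).2]
      exact congrArg Subtype.val (hf' (f ⟨x, hx⟩) ⟨x, hx⟩ (hf ⟨x, hx⟩).symm).symm
    · exact (hf ⟨x, hx⟩).adj_sub
  · rw [SimpleGraph.tutte] at hM
    push Not at hM
    obtain ⟨u, hu⟩ := hM
    rw [SimpleGraph.IsTutteViolator] at hu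
    set T : Finset V := u.toFinset.image Subtype.val with hT
    have hTu : T.card = u.ncard := by
      rw [hT, Finset.card_image_of_injective _ Subtype.val_injective, Set.ncard_eq_toFinset_card']
    refine ⟨T, ?_, ?_⟩
    · intro x hx
      obtain ⟨y, -, rfl⟩ := Finset.mem_image.1 hx
      exact y.2
    rw [hTu]
    refine hu.trans_le ?_
    set K := ((⊤ : H.Subgraph).deleteVerts u).coe with hK
    obtain ⟨Φ, hΦ⟩ := exists_component_equiv (G := G) K (fun w => (w.1.1 : V))
      (fun a b hab => Subtype.ext (Subtype.ext hab))
      (by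
        intro a b
        have ha := a.2
        have hb := b.2
        simp only [SimpleGraph.Subgraph.deleteVerts_verts, SimpleGraph.Subgraph.verts_top,
          Set.mem_sdiff, Set.mem_univ, true_and] at ha hb
        simp [hK, hH, ha, hb])
      (A \ T) (by
        intro x
        rw [Finset.mem_sdiff, hT, Finset.mem_image]
        constructor
        · rintro ⟨hx, hxu⟩
          refine ⟨⟨⟨x, hx⟩, ?_⟩, rfl⟩
          simp only [SimpleGraph.Subgraph.deleteVerts_verts, SimpleGraph.Subgraph.verts_top,
            Set.mem_sdiff, Set.mem_univ, true_and]
          exact fun hu => hxu ⟨⟨x, hx⟩, Set.mem_toFinset.2 hu, rfl⟩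
        · rintro ⟨⟨w, hw⟩, rfl⟩
          simp only [SimpleGraph.Subgraph.deleteVerts_verts, SimpleGraph.Subgraph.verts_top,
            Set.mem_sdiff, Set.mem_univ, true_and] at hw
          refine ⟨w.2, ?_⟩
          rintro ⟨v, hv, hvw⟩
          obtain rfl := Subtype.ext hvw
          exact hw (Set.mem_toFinset.1 hv))
    rw [← Set.ncard_coe_finset]
    refine Set.ncard_le_ncard_of_injOn (fun c => (Φ c : Finset V)) ?_ ?_ (Finset.finite_toSet _)
    · intro c hc
      rw [Finset.mem_coe, mem_oddComps]
      refine ⟨(Φ c).2, ?_⟩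
      rw [hΦ, Finset.card_image_of_injective _ (fun a b hab => Subtype.ext (Subtype.ext hab))]
      have hc : Odd c.supp.ncard := hc
      rw [Set.ncard_eq_toFinset_card'] at hc
      convert hc using 2
      ext; simp
    · intro c _ d _ hcd
      exact Φ.injective (Subtype.ext hcd)

open scoped Classical in
/-- The components of the graph induced on `U` that are factor-critical. -/
noncomputable def criticalComps (G : SimpleGraph V) (U : Finset V) : Finset (Finset V) :=
  (comps G U).filter (FactorCritical G)

/-- Among the sets leaving more odd components than their size (the empty set is one, by parity)
take a largest `T`. Then every odd component is factor-critical, since a failure inside one of them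
would enlarge `T`. -/
theorem exists_lt_card_criticalComps {R : Finset V} (hR : Odd R.card) :
    ∃ T ⊆ R, T.card < (criticalComps G (R \ T)).card := by
  classical
  have hex : (R.powerset.filter fun T => T.card < (oddComps G (R \ T)).card).Nonempty := by
    refine ⟨∅, ?_⟩
    simp only [Finset.mem_filter, Finset.mem_powerset, Finset.empty_subset, true_and,
      Finset.card_empty, Finset.sdiff_empty]
    exact ((odd_card_oddComps R).2 hR).pos
  obtain ⟨T, hT, hmax⟩ := Finset.exists_max_image _ Finset.card hex
  simp only [Finset.mem_filter, Finset.mem_powerset] at hT hmax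
  refine ⟨T, hT.1, hT.2.trans_le (Finset.card_le_card ?_)⟩
  intro Q hQ
  rw [mem_oddComps] at hQ
  obtain ⟨hQc, hQodd⟩ := hQ
  have hQ' := mem_comps.1 hQc
  rw [criticalComps, Finset.mem_filter]
  refine ⟨hQc, hQ'.2.1.1, fun v hv => ?_⟩
  by_contra hm
  obtain ⟨T₁, hT₁, hlt⟩ := exists_lt_card_oddComps hm
  have hvT₁ : v ∉ T₁ := fun h => by simpa using hT₁ h
  have hT₁Q : T₁ ⊆ Q := hT₁.trans (Finset.erase_subset _ _)
  -- The number of odd components of `Q - v - T₁` has the parity of `|Q| - 1 - |T₁|`, hence of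
  -- `|T₁|`, because `|Q|` is odd. An excess of one is therefore an excess of two.
  have hpar : T₁.card + 2 ≤ (oddComps G (Q.erase v \ T₁)).card := by
    have h1 := odd_card_oddComps (G := G) (Q.erase v \ T₁)
    have h2 : (Q.erase v \ T₁).card + T₁.card + 1 = Q.card := by
      rw [Finset.card_sdiff_add_card_eq_card hT₁, Finset.card_erase_add_one hv]
    rw [← h2] at hQodd
    by_contra hcon
    have h3 : (oddComps G (Q.erase v \ T₁)).card = T₁.card + 1 := by omega
    rw [h3] at h1
    grind
  set T' := T ∪ insert v T₁ with hT'
  have hdT : Disjoint T (insert v T₁) := by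
    rw [Finset.disjoint_left]
    intro x hx hx'
    have : x ∈ Q := by
      rcases Finset.mem_insert.1 hx' with rfl | h
      · exact hv
      · exact hT₁Q h
    exact (Finset.mem_sdiff.1 (hQ'.1 this)).2 hx
  have hcard : T'.card = T.card + T₁.card + 1 := by
    rw [hT', Finset.card_union_of_disjoint hdT, Finset.card_insert_of_notMem hvT₁, add_assoc]
  -- Replacing `Q` by the odd components of `Q - v - T₁` loses one component and gains at least
  -- `|T₁| + 2`, while the deleted set grows by `|T₁| + 1`; so `T'` still violates, against
  -- maximality.
  have hsub : (oddComps G (R \ T)).erase Q ∪ oddComps G (Q.erase v \ T₁) ⊆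
      oddComps G (R \ T') := by
    intro C hC
    rw [Finset.mem_union] at hC
    rcases hC with hC | hC
    · rw [Finset.mem_erase, mem_oddComps] at hC
      have hC' := mem_comps.1 hC.2.1
      have hd := comps_disjoint hC.2.1 hQc hC.1
      refine mem_oddComps.2 ⟨comps_transfer hC.2.1 ?_ (hC'.2.2.mono ?_), hC.2.2⟩
      · intro x hx
        have hxQ : x ∉ Q := fun h => Finset.disjoint_left.1 hd hx h
        have := hC'.1 hx
        rw [Finset.mem_sdiff] at this ⊢
        refine ⟨this.1, ?_⟩
        rw [hT']
        simp only [Finset.mem_union, Finset.mem_insert, not_or]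
        exact ⟨this.2, fun e => hxQ (e ▸ hv), fun h => hxQ (hT₁Q h)⟩
      · exact Finset.sdiff_subset_sdiff (Finset.Subset.refl _) Finset.subset_union_left
    · rw [mem_oddComps] at hC
      have hC' := mem_comps.1 hC.1
      refine mem_oddComps.2 ⟨comps_transfer hC.1 ?_ ?_, hC.2⟩
      · intro x hx
        have := hC'.1 hx
        simp only [Finset.mem_sdiff, Finset.mem_erase] at this
        have h2 := Finset.mem_sdiff.1 (hQ'.1 this.1.2)
        rw [Finset.mem_sdiff, hT']
        simp only [Finset.mem_union, Finset.mem_insert, not_or]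
        exact ⟨h2.1, h2.2, this.1.1, this.2⟩
      · intro x hx y hy hxy
        have hxQ := hC'.1 hx
        simp only [Finset.mem_sdiff, Finset.mem_erase] at hxQ
        rw [Finset.mem_sdiff, hT'] at hy
        simp only [Finset.mem_union, Finset.mem_insert, not_or] at hy
        have hyQ : y ∈ Q := hQ'.2.2 x hxQ.1.2 y (by simp [hy]) hxy
        exact hC'.2.2 x hx y (by simp [hy, hyQ]) hxy
  have hdis : Disjoint ((oddComps G (R \ T)).erase Q) (oddComps G (Q.erase v \ T₁)) := by
    rw [Finset.disjoint_left]
    intro C hC hC2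
    rw [Finset.mem_erase, mem_oddComps] at hC
    have hC2' := mem_comps.1 (mem_oddComps.1 hC2).1
    obtain ⟨x, hx⟩ := hC2'.2.1.1
    have hxQ := hC2'.1 hx
    simp only [Finset.mem_sdiff, Finset.mem_erase] at hxQ
    exact hC.1 (comps_eq hC.2.1 hQc hx hxQ.1.2)
  have hle := Finset.card_le_card hsub
  rw [Finset.card_union_of_disjoint hdis,
    Finset.card_erase_of_mem (mem_oddComps.2 ⟨hQc, hQodd⟩)] at hle
  have := hmax T' ⟨?_, by omega⟩
  · omega
  · rw [hT']
    refine Finset.union_subset hT.1 ?_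
    intro x hx
    have : x ∈ Q := by
      rcases Finset.mem_insert.1 hx with rfl | h
      · exact hv
      · exact hT₁Q h
    exact (Finset.mem_sdiff.1 (hQ'.1 this)).1

end Tutte

/-! ### Hall's theorem with capacities -/

section Hall

/-- Hall's theorem with capacities: every member of `𝒞` is assigned a neighbour so that each
`s ∈ S` receives exactly `c s` members. -/
theorem exists_assignment {α β : Type*} [DecidableEq α] [DecidableEq β] [Nonempty α] (𝒞 : Finset β)
    (N : β → Finset α) (S : Finset α) (c : α → ℕ) (hN : ∀ C ∈ 𝒞, N C ⊆ S)
    (h : ∀ 𝒟 ⊆ 𝒞, 𝒟.card ≤ ∑ s ∈ 𝒟.biUnion N, c s) (hc : ∑ s ∈ S, c s = 𝒞.card) :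
    ∃ f : β → α, (∀ C ∈ 𝒞, f C ∈ N C) ∧ ∀ s ∈ S, (𝒞.filter fun C => f C = s).card = c s := by
  classical
  -- Replace every `s` by `c s` copies, encoded as pairs, and apply the ordinary Hall theorem.
  have hall := (Finset.all_card_le_biUnion_card_iff_exists_injective
    (fun C : {C // C ∈ 𝒞} => (N C.1).sigma fun s => (Finset.univ : Finset (Fin (c s))))).1 (by
      intro 𝒟
      have h1 := h (𝒟.image Subtype.val) (by
        intro C hC
        obtain ⟨D, -, rfl⟩ := Finset.mem_image.1 hC
        exact D.2)
      rw [Finset.card_image_of_injective _ Subtype.val_injective] at h1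
      refine h1.trans (le_of_eq ?_)
      have : (𝒟.biUnion fun C => (N C.1).sigma fun s => (Finset.univ : Finset (Fin (c s)))) =
          ((𝒟.image Subtype.val).biUnion N).sigma fun s => Finset.univ := by
        ext ⟨s, i⟩
        simp
      rw [this, Finset.card_sigma]
      simp)
  obtain ⟨F, hF, hFN⟩ := hall
  have hFN' : ∀ C, (F C).1 ∈ N C.1 := fun C => (Finset.mem_sigma.1 (hFN C)).1
  rcases 𝒞.eq_empty_or_nonempty with rfl | ⟨C₀, hC₀⟩
  · rcases S.eq_empty_or_nonempty with rfl | ⟨s₀, hs₀⟩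
    · exact ⟨fun _ => Classical.arbitrary α, by simp, by simp⟩
    · refine ⟨fun _ => s₀, by simp, fun s hs => ?_⟩
      simp only [Finset.card_empty, Finset.sum_eq_zero_iff] at hc
      simp [hc s hs]
  set f : β → α := fun C => if hC : C ∈ 𝒞 then (F ⟨C, hC⟩).1 else (F ⟨C₀, hC₀⟩).1 with hf
  have hfN : ∀ C ∈ 𝒞, f C ∈ N C := by
    intro C hC
    simp only [hf, hC, dif_pos]
    exact hFN' ⟨C, hC⟩
  have hle : ∀ s ∈ S, (𝒞.filter fun C => f C = s).card ≤ c s := by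
    intro s _
    have : (𝒞.filter fun C => f C = s).card ≤
        (({s} : Finset α).sigma fun s => (Finset.univ : Finset (Fin (c s)))).card := by
      refine Finset.card_le_card_of_injOn
        (fun C => if hC : C ∈ 𝒞 then F ⟨C, hC⟩ else F ⟨C₀, hC₀⟩) ?_ ?_
      · intro C hC
        have hC := Finset.mem_filter.1 (Finset.mem_coe.1 hC)
        have h2 := hC.2
        simp only [hf, hC.1, dif_pos] at h2
        simp [hC.1, h2]
      · intro C hC D hD hCD
        have hC := (Finset.mem_filter.1 (Finset.mem_coe.1 hC)).1
        have hD := (Finset.mem_filter.1 (Finset.mem_coe.1 hD)).1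
        simp only [hC, hD, dif_pos] at hCD
        exact congrArg Subtype.val (hF hCD)
    simpa using this
  refine ⟨f, hfN, ?_⟩
  -- No fibre exceeds its capacity and the totals agree, so every capacity is attained exactly.
  have hsum : ∑ s ∈ S, (𝒞.filter fun C => f C = s).card = ∑ s ∈ S, c s := by
    rw [hc]
    exact (Finset.card_eq_sum_card_fiberwise fun C hC => hN C hC (hfN C hC)).symm
  exact (Finset.sum_eq_sum_iff_of_le hle).1 hsum

end Hall

/-! ### Barriers: assigning sun components to deleted vertices -/

section Barriers

variable {V : Type*} [DecidableEq V] {G G' : SimpleGraph V} {U S : Finset V}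

/-- Deleting any set `S` of vertices from the graph induced on `U` leaves at most `2 |S|` sun
components. -/
def Good (G : SimpleGraph V) (U : Finset V) : Prop :=
  ∀ S ⊆ U, (suns G (U \ S)).card ≤ 2 * S.card

open scoped Classical in
/-- The vertices of `S` with a neighbour in `C`. -/
noncomputable def nbrs (G : SimpleGraph V) (S C : Finset V) : Finset V :=
  S.filter fun s => ∃ z ∈ C, G.Adj s z

theorem mem_nbrs {C : Finset V} {s : V} : s ∈ nbrs G S C ↔ s ∈ S ∧ ∃ z ∈ C, G.Adj s z := by
  simp [nbrs]

/-- The vertices in the components of `U \ S` that are not suns. -/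
noncomputable def rest (G : SimpleGraph V) (U S : Finset V) : Finset V :=
  (U \ S) \ (suns G (U \ S)).biUnion id

theorem mem_rest {x : V} :
    x ∈ rest G U S ↔ (x ∈ U ∧ x ∉ S) ∧ ∀ C ∈ suns G (U \ S), x ∉ C := by
  simp [rest]

theorem suns_subset {C : Finset V} (hC : C ∈ suns G U) : C ⊆ U :=
  (mem_comps.1 (mem_suns.1 hC).1).1

theorem suns_closed {C : Finset V} (hC : C ∈ suns G U) : Closed G U C :=
  (mem_comps.1 (mem_suns.1 hC).1).2.2

theorem suns_nonempty {C : Finset V} (hC : C ∈ suns G U) : C.Nonempty :=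
  (mem_comps.1 (mem_suns.1 hC).1).2.1.1

theorem suns_isSun {C : Finset V} (hC : C ∈ suns G U) : IsSun G C := (mem_suns.1 hC).2

theorem suns_disjoint {C D : Finset V} (hC : C ∈ suns G U) (hD : D ∈ suns G U) (h : C ≠ D) :
    Disjoint C D := comps_disjoint (suns_subset_comps hC) (suns_subset_comps hD) h

theorem notMem_of_mem_suns {C : Finset V} (hC : C ∈ suns G (U \ S)) {x : V} (hx : x ∈ S) :
    x ∉ C := fun h => (Finset.mem_sdiff.1 (suns_subset hC h)).2 hx

theorem closed_rest : Closed G (U \ S) (rest G U S) := by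
  intro x hx y hy hxy
  rw [mem_rest] at hx ⊢
  refine ⟨by simpa using hy, fun C hC hyC => hx.2 C hC ?_⟩
  exact suns_closed hC y hyC x (by simpa using hx.1) hxy.symm

theorem suns_subset_suns_of_closed {D T : Finset V} (hD : D ⊆ U) (hcl : Closed G U D) :
    suns G (D \ T) ⊆ suns G (U \ T) := by
  intro C hC
  have hCs := suns_subset hC
  refine suns_transfer hC (hCs.trans (Finset.sdiff_subset_sdiff hD (Finset.Subset.refl _))) ?_
  intro x hx y hy hxy
  rw [Finset.mem_sdiff] at hy
  have hxD := (Finset.mem_sdiff.1 (hCs hx)).1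
  exact suns_closed hC x hx y (by simp [hcl x hxD y hy.1 hxy, hy.2]) hxy

theorem Good.of_closed (h : Good G U) {D : Finset V} (hD : D ⊆ U) (hcl : Closed G U D) :
    Good G D := fun T hT =>
  (Finset.card_le_card (suns_subset_suns_of_closed hD hcl)).trans (h T (hT.trans hD))

theorem rest_subset : rest G U S ⊆ U := fun _ hx => (mem_rest.1 hx).1.1

/-- Deleting a further set inside `rest` leaves the suns of `U \ S` untouched, so the two families
of suns add up. This makes the bounds for `S ∪ T` in `U` give bounds for `T` in `rest`. -/
theorem card_suns_rest_add {T : Finset V} (hT : T ⊆ rest G U S) :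
    (suns G (rest G U S \ T)).card + (suns G (U \ S)).card ≤ (suns G (U \ (S ∪ T))).card := by
  classical
  rw [← Finset.card_union_of_disjoint]
  · refine Finset.card_le_card (Finset.union_subset ?_ ?_)
    · rw [← Finset.sup_eq_union, ← sdiff_sdiff]
      exact suns_subset_suns_of_closed
        (fun x hx => by simpa using (mem_rest.1 hx).1) closed_rest
    · intro C hC
      have hsub := suns_subset hC
      refine suns_transfer hC ?_ ((suns_closed hC).mono ?_)
      · intro x hx
        have hx' := Finset.mem_sdiff.1 (hsub hx)
        have hxT : x ∉ T := fun h => (mem_rest.1 (hT h)).2 C hC hx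
        simp [hx'.1, hx'.2, hxT]
      · exact Finset.sdiff_subset_sdiff (Finset.Subset.refl _) Finset.subset_union_left
  · rw [Finset.disjoint_left]
    intro C hC hC'
    obtain ⟨x, hx⟩ := suns_nonempty hC
    exact (mem_rest.1 (Finset.mem_sdiff.1 (suns_subset hC hx)).1).2 C hC' hx

theorem suns_of_nbrs_subset {C N : Finset V} (hN : N ⊆ S) (hC : C ∈ suns G (U \ S))
    (hCN : nbrs G S C ⊆ N) : C ∈ suns G (U \ N) := by
  refine suns_transfer hC ?_ ?_
  · exact (suns_subset hC).trans (Finset.sdiff_subset_sdiff (Finset.Subset.refl _) hN)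
  · intro x hx y hy hxy
    rw [Finset.mem_sdiff] at hy
    have hyS : y ∉ S := fun h => hy.2 (hCN (mem_nbrs.2 ⟨h, x, hx, hxy.symm⟩))
    exact suns_closed hC x hx y (by simp [hy.1, hyS]) hxy

/-- Source of Hall's condition: a sun stays a component when only its neighbours in `S` are deleted,
so the hypothesis on suns can be applied to the neighbourhood of `𝒟`. -/
theorem card_le_card_suns_nbrs {𝒟 : Finset (Finset V)} (h𝒟 : 𝒟 ⊆ suns G (U \ S)) :
    𝒟.card ≤ (suns G (U \ 𝒟.biUnion (nbrs G S))).card := by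
  refine Finset.card_le_card fun C hC => suns_of_nbrs_subset ?_ (h𝒟 hC) ?_
  · intro x hx
    obtain ⟨D, -, hD⟩ := Finset.mem_biUnion.1 hx
    exact (mem_nbrs.1 hD).1
  · exact Finset.subset_biUnion_of_mem (nbrs G S) hC

theorem hasCover_fiber {s : V} {𝒞 : Finset (Finset V)} (h𝒞 : 𝒞 ⊆ suns G (U \ S))
    (hs : ∀ C ∈ 𝒞, s ∈ nbrs G S C) (h2 : 𝒞.card = 2) : HasCover G (insert s (𝒞.biUnion id)) := by
  obtain ⟨C, D, hCD, rfl⟩ := Finset.card_eq_two.1 h2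
  have hC := h𝒞 (show C ∈ _ by simp)
  have hD := h𝒞 (show D ∈ _ by simp)
  obtain ⟨hsS, z, hz, hsz⟩ := mem_nbrs.1 (hs C (by simp))
  obtain ⟨-, w, hw, hsw⟩ := mem_nbrs.1 (hs D (by simp))
  have := HasCover.of_arms ((suns_isSun hC).arm hz hsz) ((suns_isSun hD).arm hw hsw)
    (suns_disjoint hC hD hCD) (notMem_of_mem_suns hC hsS) (notMem_of_mem_suns hD hsS)
  simpa using this

/-- A cover assembled from an assignment of the sun components of `U \ S` to vertices of `S`: every
vertex of `S` outside `E` receives two components. -/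
theorem hasCover_of_assignment (hS : S ⊆ U) (g : Finset V → V)
    (hg : ∀ C ∈ suns G (U \ S), g C ∈ nbrs G S C) (E : Finset V) (hES : E ⊆ S)
    (h2 : ∀ s ∈ S, s ∉ E → ((suns G (U \ S)).filter fun C => g C = s).card = 2)
    (hE : HasCover G (rest G U S ∪
      (E ∪ ((suns G (U \ S)).filter fun C => g C ∈ E).biUnion id))) : HasCover G U := by
  have h1 : HasCover G ((S \ E).biUnion fun s =>
      insert s (((suns G (U \ S)).filter fun C => g C = s).biUnion id)) := by
    refine HasCover.biUnion _ _ ?_ ?_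
    · intro s hs
      rw [Finset.mem_sdiff] at hs
      refine hasCover_fiber (U := U) (S := S) (Finset.filter_subset _ _) ?_ (h2 s hs.1 hs.2)
      intro C hC
      rw [Finset.mem_filter] at hC
      exact hC.2 ▸ hg C hC.1
    · intro s hs t ht hst
      rw [Finset.mem_sdiff] at hs ht
      rw [Finset.disjoint_left]
      intro x hx hx'
      simp only [Finset.mem_insert, Finset.mem_biUnion, Finset.mem_filter, id] at hx hx'
      rcases hx with rfl | ⟨C, ⟨hC, hCs⟩, hxC⟩
      · rcases hx' with rfl | ⟨D, ⟨hD, hDs⟩, hxD⟩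
        · exact hst rfl
        · exact notMem_of_mem_suns hD hs.1 hxD
      · rcases hx' with rfl | ⟨D, ⟨hD, hDs⟩, hxD⟩
        · exact notMem_of_mem_suns hC ht.1 hxC
        · have := comps_eq (suns_subset_comps hC) (suns_subset_comps hD) hxC hxD
          subst this
          exact hst (hCs.symm.trans hDs)
  have h3 := h1.union hE (by
    rw [Finset.disjoint_left]
    intro x hx hx'
    simp only [Finset.mem_insert, Finset.mem_biUnion, Finset.mem_filter, id, Finset.mem_union,
      Finset.mem_sdiff] at hx hx'
    obtain ⟨s, hs, rfl | ⟨C, ⟨hC, hCs⟩, hxC⟩⟩ := hx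
    · rcases hx' with hx' | hx' | ⟨D, ⟨hD, hDs⟩, hxD⟩
      · exact (mem_rest.1 hx').1.2 hs.1
      · exact hs.2 hx'
      · exact notMem_of_mem_suns hD hs.1 hxD
    · rcases hx' with hx' | hx' | ⟨D, ⟨hD, hDs⟩, hxD⟩
      · exact (mem_rest.1 hx').2 C hC hxC
      · exact notMem_of_mem_suns hC (hES hx') hxC
      · have := comps_eq (suns_subset_comps hC) (suns_subset_comps hD) hxC hxD
        subst this
        exact hs.2 (hCs ▸ hDs))
  convert h3 using 1
  ext x
  simp only [Finset.mem_insert, Finset.mem_biUnion, Finset.mem_filter, id, Finset.mem_union,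
    Finset.mem_sdiff]
  constructor
  · intro hx
    by_cases hxS : x ∈ S
    · by_cases hxE : x ∈ E
      · exact Or.inr (Or.inr (Or.inl hxE))
      · exact Or.inl ⟨x, ⟨hxS, hxE⟩, Or.inl rfl⟩
    · by_cases hxr : ∃ C ∈ suns G (U \ S), x ∈ C
      · obtain ⟨C, hC, hxC⟩ := hxr
        by_cases hgE : g C ∈ E
        · exact Or.inr (Or.inr (Or.inr ⟨C, ⟨hC, hgE⟩, hxC⟩))
        · exact Or.inl ⟨g C, ⟨(mem_nbrs.1 (hg C hC)).1, hgE⟩, Or.inr ⟨C, ⟨hC, rfl⟩, hxC⟩⟩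
      · push Not at hxr
        exact Or.inr (Or.inl (mem_rest.2 ⟨⟨hx, hxS⟩, hxr⟩))
  · have hsun : ∀ C ∈ suns G (U \ S), x ∈ C → x ∈ U := fun C hC hx =>
      (Finset.mem_sdiff.1 (suns_subset hC hx)).1
    rintro (⟨s, hs, rfl | ⟨C, ⟨hC, -⟩, hxC⟩⟩ | hx | hx | ⟨C, ⟨hC, -⟩, hxC⟩)
    · exact hS hs.1
    · exact hsun C hC hxC
    · exact rest_subset hx
    · exact hS (hES hx)
    · exact hsun C hC hxC

/-- At equality Hall's theorem with all capacities two uses up every sun, and no exceptional vertex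
is left. -/
theorem hasCover_of_card_eq_two_mul [Nonempty V] (hG : Good G U) (hS : S ⊆ U)
    (hcard : (suns G (U \ S)).card = 2 * S.card) (hrest : HasCover G (rest G U S)) :
    HasCover G U := by
  obtain ⟨f, hf, hf2⟩ := exists_assignment (suns G (U \ S)) (nbrs G S) S (fun _ => 2)
    (fun C _ x hx => (mem_nbrs.1 hx).1) (by
      intro 𝒟 h𝒟
      have h1 := card_le_card_suns_nbrs h𝒟
      have h2 := hG (𝒟.biUnion (nbrs G S)) (by
        intro x hx
        obtain ⟨D, -, hD⟩ := Finset.mem_biUnion.1 hx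
        exact hS (mem_nbrs.1 hD).1)
      simp only [Finset.sum_const, smul_eq_mul]
      omega) (by simp [hcard, mul_comm])
  refine hasCover_of_assignment hS f hf ∅ (by simp) (fun s hs _ => hf2 s hs) ?_
  simpa using hrest

theorem biUnion_nbrs_subset {𝒟 : Finset (Finset V)} : 𝒟.biUnion (nbrs G S) ⊆ S := by
  intro x hx
  obtain ⟨D, -, hD⟩ := Finset.mem_biUnion.1 hx
  exact (mem_nbrs.1 hD).1

/-- A strict form of `Good` for nonempty sets. -/
def Strict (G : SimpleGraph V) (U : Finset V) : Prop :=
  ∀ S ⊆ U, S.Nonempty → (suns G (U \ S)).card < 2 * S.card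

/-- Strictness leaves one unit of slack in Hall's condition. A nonempty family cannot have an empty
neighbourhood, since `Good` at the empty set says that `U` has no sun component. -/
theorem card_lt_of_strict (hG : Good G U) (hst : Strict G U) (hS : S ⊆ U)
    {𝒟 : Finset (Finset V)} (h𝒟 : 𝒟 ⊆ suns G (U \ S)) (h0 : 𝒟.Nonempty) :
    𝒟.card < 2 * (𝒟.biUnion (nbrs G S)).card := by
  have h1 := card_le_card_suns_nbrs h𝒟
  rcases (𝒟.biUnion (nbrs G S)).eq_empty_or_nonempty with he | hne
  · rw [he] at h1
    have h2 := hG ∅ (by simp)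
    have h3 := h0.card_pos
    rw [Finset.card_empty] at h2
    omega
  · have := hst _ (biUnion_nbrs_subset.trans hS) hne
    omega

/-- In a strict situation with `2 |S| - 1` suns, every vertex of `S` can be chosen to be the one that
receives only one sun. -/
theorem exists_assignment_alone [Nonempty V] (hG : Good G U) (hst : Strict G U) (hS : S ⊆ U)
    (hcard : (suns G (U \ S)).card + 1 = 2 * S.card) {s₀ : V} (hs₀ : s₀ ∈ S) :
    ∃ f : Finset V → V, (∀ C ∈ suns G (U \ S), f C ∈ nbrs G S C) ∧
      (∀ s ∈ S, s ≠ s₀ → ((suns G (U \ S)).filter fun C => f C = s).card = 2) ∧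
      ∃ C₀ ∈ suns G (U \ S), ((suns G (U \ S)).filter fun C => f C = s₀) = {C₀} := by
  have hsum : ∀ N : Finset V, ∑ s ∈ N, (if s = s₀ then 1 else 2) +
      (if s₀ ∈ N then 1 else 0) = 2 * N.card := by
    intro N
    have : ∑ s ∈ N, ((if s = s₀ then 1 else 2) + (if s = s₀ then 1 else 0)) = 2 * N.card := by
      rw [mul_comm, ← smul_eq_mul, ← Finset.sum_const]
      refine Finset.sum_congr rfl fun s _ => ?_
      split_ifs <;> rfl
    rw [Finset.sum_add_distrib, Finset.sum_ite_eq' N s₀ (fun _ => 1)] at this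
    exact this
  -- The capacity of `s₀` is lowered to one; the slack in the strict Hall condition pays for the
  -- missing unit.
  obtain ⟨f, hf, hf2⟩ := exists_assignment (suns G (U \ S)) (nbrs G S) S
    (fun s => if s = s₀ then 1 else 2)
    (fun C _ x hx => (mem_nbrs.1 hx).1) (by
      intro 𝒟 h𝒟
      rcases 𝒟.eq_empty_or_nonempty with rfl | h0
      · simp
      have h1 := card_lt_of_strict hG hst hS h𝒟 h0
      have h2 := hsum (𝒟.biUnion (nbrs G S))
      split_ifs at h2 <;> omega) (by
      have := hsum S
      rw [if_pos hs₀] at this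
      omega)
  refine ⟨f, hf, fun s hs hne => by simpa [hne] using hf2 s hs, ?_⟩
  have := hf2 s₀ hs₀
  rw [if_pos rfl, Finset.card_eq_one] at this
  obtain ⟨C₀, hC₀⟩ := this
  have hmem : C₀ ∈ (suns G (U \ S)).filter fun C => f C = s₀ := by rw [hC₀]; simp
  exact ⟨C₀, (Finset.mem_filter.1 hmem).1, hC₀⟩

/-- In a strict situation with `2 |S| - 1` suns, a sun `D` can be used by two vertices of `S`. -/
theorem hasCover_of_split [Nonempty V] (hG : Good G U) (hst : Strict G U) (hS : S ⊆ U)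
    (hcard : (suns G (U \ S)).card + 1 = 2 * S.card) (hrest : HasCover G (rest G U S))
    {D : Finset V} (hD : D ∈ suns G (U \ S)) {A B : Finset V} (hA : A.Nonempty) (hB : B.Nonempty)
    (hAB : A ∪ B = nbrs G S D)
    (hne : ∀ s ∈ A, s ∈ B → ∃ E ∈ suns G (U \ S), E ≠ D ∧ nbrs G S E = {s})
    (hcov : ∀ s ∈ A, ∀ t ∈ B, s ≠ t → ∀ X ∈ suns G (U \ S), ∀ Y ∈ suns G (U \ S), X ≠ Y → X ≠ D →
      Y ≠ D → s ∈ nbrs G S X → t ∈ nbrs G S Y →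
      HasCover G (insert s (insert t (X ∪ Y ∪ D)))) : HasCover G U := by
  classical
  set 𝒮 := suns G (U \ S) with h𝒮
  have hAS : A ⊆ S := fun x hx => (mem_nbrs.1 (hAB ▸ Finset.mem_union_left B hx)).1
  have hBS : B ⊆ S := fun x hx => (mem_nbrs.1 (hAB ▸ Finset.mem_union_right A hx)).1
  -- The sun `D` is doubled: `some D` may be assigned within `A`, and the extra element `none`
  -- stands for a second copy assigned within `B`. This makes `2|S|` elements for `|S|` vertices of
  -- capacity two.
  let N : Option (Finset V) → Finset V := fun o =>
    o.elim B fun C => if C = D then A else nbrs G S C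
  have hNnone : N none = B := rfl
  have hND : N (some D) = A := by simp [N]
  have hNC : ∀ C, C ≠ D → N (some C) = nbrs G S C := fun C hC => by simp [N, hC]
  obtain ⟨f, hf, hf2⟩ := exists_assignment (Finset.insertNone 𝒮) N S (fun _ => 2)
    (by
      rintro (_ | C) hC
      · exact hBS
      · by_cases hCD : C = D
        · rw [hCD, hND]; exact hAS
        · rw [hNC C hCD]; exact fun x hx => (mem_nbrs.1 hx).1)
    (by
      intro 𝒟 h𝒟
      simp only [Finset.sum_const, smul_eq_mul]
      have hsub : Finset.eraseNone 𝒟 ⊆ 𝒮 := by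
        intro C hC
        rw [Finset.mem_eraseNone] at hC
        simpa using h𝒟 hC
      have hc1 : 𝒟.card ≤ (Finset.eraseNone 𝒟).card + 1 := by
        have : 𝒟 ⊆ Finset.insertNone (Finset.eraseNone 𝒟) := by
          intro o ho
          rcases o with _ | C
          · simp
          · simpa using ho
        have := Finset.card_le_card this
        rwa [Finset.card_insertNone] at this
      -- With both copies present, the neighbourhood contains `A ∪ B`, all neighbours of `D`, and
      -- the strict bound for the undoubled family absorbs the extra copy.
      by_cases hboth : none ∈ 𝒟 ∧ some D ∈ 𝒟
      · have hsub2 : (Finset.eraseNone 𝒟).biUnion (nbrs G S) ⊆ 𝒟.biUnion N := by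
          intro x hx
          obtain ⟨C, hC, hxC⟩ := Finset.mem_biUnion.1 hx
          rw [Finset.mem_eraseNone] at hC
          rw [Finset.mem_biUnion]
          by_cases hCD : C = D
          · subst hCD
            rw [← hAB, Finset.mem_union] at hxC
            rcases hxC with h | h
            · exact ⟨some C, hC, by rwa [hND]⟩
            · exact ⟨none, hboth.1, h⟩
          · exact ⟨some C, hC, by rwa [hNC C hCD]⟩
        have h1 := card_lt_of_strict hG hst hS hsub ⟨D, by simpa using hboth.2⟩
        have h2 := Finset.card_le_card hsub2
        omega
      -- With at most one copy present, drop it: the strict bound for the other suns absorbs it. If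
      -- nothing else is left, the nonempty neighbourhood already offers capacity two.
      · have hc2 : 𝒟.card ≤ ((Finset.eraseNone 𝒟).erase D).card + 1 := by
          by_cases hDD : D ∈ Finset.eraseNone 𝒟
          · have hnone : none ∉ 𝒟 := fun h => hboth ⟨h, by simpa using hDD⟩
            have h3 : 𝒟.card = (Finset.eraseNone 𝒟).card := by
              rw [Finset.card_eraseNone_of_not_mem hnone]
            have := Finset.card_erase_add_one hDD
            omega
          · rw [Finset.erase_eq_of_notMem hDD]
            exact hc1
        have hsub2 : ((Finset.eraseNone 𝒟).erase D).biUnion (nbrs G S) ⊆ 𝒟.biUnion N := by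
          intro x hx
          obtain ⟨C, hC, hxC⟩ := Finset.mem_biUnion.1 hx
          rw [Finset.mem_erase, Finset.mem_eraseNone] at hC
          rw [Finset.mem_biUnion]
          exact ⟨some C, hC.2, by rwa [hNC C hC.1]⟩
        rcases ((Finset.eraseNone 𝒟).erase D).eq_empty_or_nonempty with he | h0
        · rw [he] at hc2
          rcases 𝒟.eq_empty_or_nonempty with rfl | ⟨o, ho⟩
          · simp
          · have hNo : (N o).Nonempty := by
              rcases o with _ | C
              · exact hB
              · by_cases hCD : C = D
                · rw [hCD, hND]; exact hA
                · have : C ∈ (Finset.eraseNone 𝒟).erase D := by simp [hCD, ho]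
                  rw [he] at this
                  simp at this
            have : (𝒟.biUnion N).Nonempty := by
              obtain ⟨x, hx⟩ := hNo
              exact ⟨x, Finset.mem_biUnion.2 ⟨o, ho, hx⟩⟩
            have := this.card_pos
            simp at hc2
            omega
        · have h1 := card_lt_of_strict hG hst hS ((Finset.erase_subset _ _).trans hsub) h0
          have h2 := Finset.card_le_card hsub2
          omega)
    (by simp [hcard, mul_comm])
  have hfD := hf (some D) (by simpa using hD)
  rw [hND] at hfD
  have hfn := hf none (by simp)
  rw [hNnone] at hfn
  have hfC : ∀ C ∈ 𝒮, f (some C) ∈ nbrs G S C := by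
    intro C hC
    by_cases hCD : C = D
    · rw [hCD, ← hAB]; exact Finset.mem_union_left _ hfD
    · have := hf (some C) (by simpa using hC)
      rwa [hNC C hCD] at this
  set s := f (some D) with hs
  set t := f none with ht
  have hsS := hAS hfD
  have htS := hBS hfn
  -- If both copies went to `s`, the sun `E` whose only neighbour is `s` would be a third one there.
  have hst' : s ≠ t := by
    intro hst'
    obtain ⟨E, hE, hED, hEs⟩ := hne s hfD (hst' ▸ hfn)
    have hfE := hfC E hE
    rw [hEs, Finset.mem_singleton] at hfE
    have h3 : ({none, some D, some E} : Finset (Option (Finset V))) ⊆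
        (Finset.insertNone 𝒮).filter fun o => f o = s := by
      intro o ho
      simp only [Finset.mem_insert, Finset.mem_singleton] at ho
      rcases ho with rfl | rfl | rfl
      · simp [← ht, hst']
      · simp [hD, ← hs]
      · simp [hE, hfE]
    have h4 := Finset.card_le_card h3
    rw [hf2 s hsS, Finset.card_insert_of_notMem (by simp), Finset.card_pair] at h4
    · omega
    · simpa using hED.symm
  obtain ⟨oX, hoX, hoXne⟩ := Finset.exists_mem_ne
    (s := (Finset.insertNone 𝒮).filter fun o => f o = s) (by rw [hf2 s hsS]; omega) (some D)
  obtain ⟨oY, hoY, hoYne⟩ := Finset.exists_mem_ne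
    (s := (Finset.insertNone 𝒮).filter fun o => f o = t) (by rw [hf2 t htS]; omega) none
  rw [Finset.mem_filter] at hoX hoY
  rcases oX with _ | X
  · exact absurd hoX.2.symm hst'
  rcases oY with _ | Y
  · exact absurd rfl hoYne
  have hX : X ∈ 𝒮 := by simpa using hoX.1
  have hY : Y ∈ 𝒮 := by simpa using hoY.1
  have hXD : X ≠ D := fun h => hoXne (by rw [h])
  have hYD : Y ≠ D := by
    rintro rfl
    exact hst' hoY.2
  have hXY : X ≠ Y := by
    rintro rfl
    exact hst' (hoX.2.symm.trans hoY.2)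
  have hfs : (Finset.insertNone 𝒮).filter (fun o => f o = s) = {some D, some X} := by
    symm
    apply Finset.eq_of_subset_of_card_le
    · intro o ho
      simp only [Finset.mem_insert, Finset.mem_singleton] at ho
      rcases ho with rfl | rfl
      · simp [hD, ← hs]
      · simp [hX, hoX.2]
    · rw [hf2 s hsS, Finset.card_pair (by simpa using hXD.symm)]
  have hft : (Finset.insertNone 𝒮).filter (fun o => f o = t) = {none, some Y} := by
    symm
    apply Finset.eq_of_subset_of_card_le
    · intro o ho
      simp only [Finset.mem_insert, Finset.mem_singleton] at ho
      rcases ho with rfl | rfl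
      · simp [← ht]
      · simp [hY, hoY.2]
    · rw [hf2 t htS, Finset.card_pair (by simp)]
  refine hasCover_of_assignment hS (fun C => f (some C)) hfC {s, t}
    (by intro x; simp only [Finset.mem_insert, Finset.mem_singleton]
        rintro (rfl | rfl) <;> assumption) ?_ ?_
  · intro s' hs' hs'E
    simp only [Finset.mem_insert, Finset.mem_singleton, not_or] at hs'E
    rw [← hf2 s' hs', ← Finset.card_map Function.Embedding.some]
    congr 1
    ext o
    rcases o with _ | C
    · simp [← ht, Ne.symm hs'E.2]
    · simp [h𝒮]
  · have hblock : (𝒮.filter fun C => f (some C) ∈ ({s, t} : Finset V)) = {X, Y, D} := by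
      ext C
      simp only [Finset.mem_filter, Finset.mem_insert, Finset.mem_singleton]
      constructor
      · rintro ⟨hC, h | h⟩
        · have : some C ∈ (Finset.insertNone 𝒮).filter (fun o => f o = s) := by simp [hC, h]
          rw [hfs] at this
          simp at this
          tauto
        · have : some C ∈ (Finset.insertNone 𝒮).filter (fun o => f o = t) := by simp [hC, h]
          rw [hft] at this
          simp at this
          tauto
      · rintro (rfl | rfl | rfl)
        · exact ⟨hX, Or.inl hoX.2⟩
        · exact ⟨hY, Or.inr hoY.2⟩
        · exact ⟨hD, Or.inl rfl⟩
    rw [hblock]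
    have hsX := hfC X hX
    have htY := hfC Y hY
    rw [hoX.2] at hsX
    rw [hoY.2] at htY
    have hc := hcov s hfD t hfn hst' X hX Y hY hXY hXD hYD hsX htY
    refine hrest.union ?_ ?_
    · convert hc using 1
      ext x
      simp only [Finset.mem_union, Finset.mem_insert, Finset.mem_singleton, Finset.mem_biUnion,
        id, exists_eq_or_imp, exists_eq_left]
      tauto
    · rw [Finset.disjoint_left]
      intro x hx hx'
      have hx := mem_rest.1 hx
      simp only [Finset.mem_union, Finset.mem_insert, Finset.mem_singleton, Finset.mem_biUnion,
        id] at hx'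
      rcases hx' with (rfl | rfl) | ⟨C, rfl | rfl | rfl, hxC⟩
      · exact hx.1.2 hsS
      · exact hx.1.2 htS
      · exact hx.2 _ hX hxC
      · exact hx.2 _ hY hxC
      · exact hx.2 _ hD hxC

end Barriers

/-! ### Kaneko's criterion: edge deletion, pendant paths and odd coronas -/

section Kaneko

variable {V : Type*} [DecidableEq V] {G G' : SimpleGraph V} {U S : Finset V}

/-- If no nonempty set is nearly a barrier, then an edge can be deleted. -/
theorem Good.deleteEdge (hU : Conn G U)
    (hnt : ∀ S ⊆ U, S.Nonempty → (suns G (U \ S)).card + 2 ≤ 2 * S.card) {x y : V} (hx : x ∈ U)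
    (hy : y ∈ U) (hxy : G.Adj x y) : Good (G.deleteEdges {s(x, y)}) U := by
  classical
  set G' := G.deleteEdges {s(x, y)} with hG'
  have hadj : ∀ a b, G'.Adj a b ↔ G.Adj a b ∧ s(a, b) ≠ s(x, y) := by
    intro a b
    rw [hG', SimpleGraph.deleteEdges_adj]
    simp
  intro S hS
  rcases S.eq_empty_or_nonempty with rfl | hS0
  · rw [Finset.sdiff_empty, Finset.card_empty, mul_zero, Nat.le_zero, Finset.card_eq_zero,
      Finset.eq_empty_iff_forall_notMem]
    intro C hC
    -- A sun created without deleting vertices is impossible. If it is all of `U`, either a pendant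
    -- vertex off the edge becomes isolated in `G` once its neighbour `m` is deleted, against `hnt
    -- {m}`, or `U` is just `{x, y}`, now disconnected. If it is a proper part, the edge was a
    -- bridge, and deleting its end `b` outside `C` leaves `C` a sun of `G`, against `hnt {b}`.
    by_cases hCU : C = U
    · subst hCU
      by_cases h3 : 3 ≤ C.card
      · obtain ⟨l, hl, m, hm, hlx, hly, hlm, hleaf⟩ := (suns_isSun hC).exists_leaf h3 x y
        have hmem : {l} ∈ suns G (C \ {m}) := by
          refine singleton_mem_suns (by simp [hl, hlm]) fun w hw hlw => ?_
          rw [Finset.mem_sdiff, Finset.mem_singleton] at hw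
          refine hw.2 (hleaf w hw.1 ((hadj _ _).2 ⟨hlw, ?_⟩))
          rw [Ne, Sym2.eq_iff]
          tauto
        have h4 := hnt {m} (by simpa using hm) (by simp)
        have h5 := Finset.card_pos.2 ⟨_, hmem⟩
        rw [Finset.card_singleton] at h4
        omega
      · have h2 : ({x, y} : Finset V) = C := by
          apply Finset.eq_of_subset_of_card_le
          · intro a; simp; rintro (rfl | rfl) <;> assumption
          · rw [Finset.card_pair hxy.ne]; omega
        have hc := (mem_comps.1 (suns_subset_comps hC)).2.1
        have h1 := hc.2 {x} (by simpa using hx) (by simp) (by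
          intro a ha b hb hab
          obtain rfl : a = x := by simpa using ha
          rw [← h2] at hb
          simp only [Finset.mem_insert, Finset.mem_singleton] at hb
          rcases hb with rfl | rfl
          · simp
          · exact absurd rfl ((hadj _ _).1 hab).2)
        rw [← h1] at hy
        exact hxy.ne (Finset.mem_singleton.1 hy).symm
    · have hsub := suns_subset hC
      obtain ⟨a, ha, b, hb, hbC, hab⟩ := hU.exists_adj hsub (suns_nonempty hC) hCU
      have hcl := suns_closed hC
      have hedge : s(a, b) = s(x, y) := by
        by_contra hne
        exact hbC (hcl a ha b hb ((hadj _ _).2 ⟨hab, hne⟩))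
      have hagree : ∀ u ∈ C, ∀ w, w ≠ b → (G'.Adj u w ↔ G.Adj u w) := by
        intro u hu w hw
        rw [hadj]
        refine ⟨fun h => h.1, fun h => ⟨h, fun he => ?_⟩⟩
        rw [← hedge, Sym2.eq_iff] at he
        rcases he with ⟨-, h⟩ | ⟨h, -⟩
        · exact hw h
        · exact hbC (h ▸ hu)
      have hmem : C ∈ suns G (U \ {b}) := by
        refine suns_congr (suns_transfer hC ?_ (hcl.mono Finset.sdiff_subset)) ?_
        · intro u hu
          simp only [Finset.mem_sdiff, Finset.mem_singleton]
          exact ⟨hsub hu, fun h => hbC (h ▸ hu)⟩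
        · intro u hu w hw
          rw [Finset.mem_sdiff, Finset.mem_singleton] at hw
          exact hagree u hu w hw.2
      have h4 := hnt {b} (by simpa using hb) (by simp)
      have h5 := Finset.card_pos.2 ⟨_, hmem⟩
      rw [Finset.card_singleton] at h4
      omega
  -- Only the components containing `x` or `y` can be new suns, at most two of them; this is the
  -- slack in `hnt`.
  · have h1 := hnt S hS hS0
    have hsub : suns G' (U \ S) ⊆ suns G (U \ S) ∪
        ((suns G' (U \ S)).filter (fun C => x ∈ C) ∪ (suns G' (U \ S)).filter (fun C => y ∈ C)) := by
      intro C hC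
      simp only [Finset.mem_union, Finset.mem_filter]
      by_cases hxC : x ∈ C
      · tauto
      by_cases hyC : y ∈ C
      · tauto
      refine Or.inl (suns_congr hC fun u hu w _ => ?_)
      rw [hadj]
      refine ⟨fun h => h.1, fun h => ⟨h, fun he => ?_⟩⟩
      rw [Sym2.eq_iff] at he
      rcases he with ⟨h, -⟩ | ⟨h, -⟩
      · exact hxC (h ▸ hu)
      · exact hyC (h ▸ hu)
    have hone : ∀ v, ((suns G' (U \ S)).filter (fun C => v ∈ C)).card ≤ 1 := by
      intro v
      rw [Finset.card_le_one]
      intro C hC D hD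
      rw [Finset.mem_filter] at hC hD
      exact comps_eq (suns_subset_comps hC.1) (suns_subset_comps hD.1) hC.2 hD.2
    have h2 := Finset.card_le_card hsub
    have h3 := Finset.card_union_le (suns G (U \ S))
      ((suns G' (U \ S)).filter (fun C => x ∈ C) ∪ (suns G' (U \ S)).filter (fun C => y ∈ C))
    have h4 := Finset.card_union_le ((suns G' (U \ S)).filter (fun C => x ∈ C))
      ((suns G' (U \ S)).filter (fun C => y ∈ C))
    have := hone x
    have := hone y
    omega

/-- A path that ends in a vertex of degree one can be prolonged. -/
theorem HasCover.insert_of_leaf (hle : G' ≤ G) (h : HasCover G' U) {s a : V} (hs : s ∈ U)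
    (hleaf : ∀ v w, G'.Adj s v → G'.Adj s w → v = w) (ha : a ∉ U) (has : G.Adj a s) :
    HasCover G (insert a U) := by
  induction h with
  | empty => simp at hs
  | @cons U l hc hn h3 hd hU ih =>
    by_cases hsl : s ∈ l
    · have hal : a ∉ l := fun h => ha (by simp [h])
      have haU : a ∉ U := fun h => ha (by simp [h])
      have key : ∀ m : List V, m.IsChain G.Adj → m.Nodup → 3 ≤ m.length →
          (∀ x, x ∈ m ↔ x = a ∨ x ∈ l) → HasCover G (insert a (l.toFinset ∪ U)) := by
        intro m h1 h2 h3 h4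
        have := HasCover.cons m h1 h2 h3 (U := U) (by
          rw [Finset.disjoint_left]
          intro x hx
          rw [List.mem_toFinset, h4] at hx
          rcases hx with rfl | hx
          · exact haU
          · exact Finset.disjoint_left.1 hd (by simpa using hx)) (hU.mono hle)
        convert this using 1
        ext x; simp [h4]; tauto
      have hc' : l.IsChain G.Adj := hc.imp fun _ _ h => hle h
      obtain ⟨p, q, rfl⟩ := List.append_of_mem hsl
      -- The path through `s` begins or ends there, so `a` can be attached; were `s` interior, its
      -- two neighbours on the path would coincide.
      rcases List.eq_nil_or_concat' p with rfl | ⟨p, u, rfl⟩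
      · refine key (a :: s :: q) ?_ ?_ (by simp at h3 ⊢; omega) (by simp)
        · simpa [has] using hc'
        · simp only [List.nil_append] at hal hn
          exact List.nodup_cons.2 ⟨hal, hn⟩
      · rcases q with _ | ⟨w, q⟩
        · refine key ((p ++ [u]) ++ [s] ++ [a]) ?_ ?_ (by simp)
            (by intro x; simp; tauto)
          · rw [List.isChain_append]
            refine ⟨hc', by simp, ?_⟩
            simp [has.symm]
          · rw [List.nodup_append]
            refine ⟨hn, by simp, ?_⟩
            intro x hx y hy
            simp only [List.mem_singleton] at hy
            subst hy
            rintro rfl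
            exact hal hx
        · exfalso
          have h1 : G'.Adj u s ∧ G'.Adj s w := by
            rw [List.append_assoc, List.singleton_append, List.isChain_append_cons_cons] at hc
            exact ⟨hc.2.1, (List.isChain_cons_cons.1 hc.2.2).1⟩
          have := hleaf u w h1.1.symm h1.2
          subst this
          simp [List.nodup_append] at hn
    · have hsU : s ∈ U := by simpa [hsl] using hs
      have haU : a ∉ U := fun h => ha (by simp [h])
      have hal : a ∉ l := fun h => ha (by simp [h])
      have := HasCover.cons l (hc.imp fun _ _ h => hle h) hn h3 (U := insert a U)
        (by rw [Finset.disjoint_insert_right]; exact ⟨by simpa using hal, hd⟩) (ih hsU haU)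
      convert this using 1
      ext x; simp

theorem comps_of_conn (hU : Conn G U) : comps G U ⊆ {U} := by
  intro C hC
  rw [mem_comps] at hC
  rw [Finset.mem_singleton]
  exact hU.2 C hC.1 hC.2.1.1 hC.2.2

/-- A component that is not a sun together with a pendant path on two vertices has a cover, if
smaller vertex sets are known to have covers. -/
theorem hasCover_pendant {K : Finset V} (hK : Conn G K) (hns : ¬ IsSun G K)
    (hst : Strict G K) {z s a : V} (hz : z ∈ K) (hs : s ∉ K) (ha : a ∉ K)
    (has : G.Adj a s) (hsz : G.Adj s z)
    (ih : ∀ G' ≤ G, Good G' (insert s K) → HasCover G' (insert s K)) :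
    HasCover G (insert a (insert s K)) := by
  classical
  -- All edges at `s` except `sz` are removed, so that in any cover `s` is an end of its path and
  -- `a` can be appended.
  let G' : SimpleGraph V :=
    { Adj := fun u v => G.Adj u v ∧ (u = s → v = z) ∧ (v = s → u = z)
      symm := ⟨fun u v h => ⟨h.1.symm, h.2.2, h.2.1⟩⟩
      loopless := ⟨fun u h => h.1.ne rfl⟩ }
  have hadj : ∀ u v, G'.Adj u v ↔ G.Adj u v ∧ (u = s → v = z) ∧ (v = s → u = z) :=
    fun _ _ => Iff.rfl
  have hle : G' ≤ G := fun u v h => h.1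
  have hsz' : G'.Adj s z := ⟨hsz, fun _ => rfl, fun h => absurd (h ▸ hz) hs⟩
  have hagree : ∀ u ∈ K, ∀ v ∈ K, (G.Adj u v ↔ G'.Adj u v) := by
    intro u hu v hv
    rw [hadj]
    exact ⟨fun h => ⟨h, fun e => absurd (e ▸ hu) hs, fun e => absurd (e ▸ hv) hs⟩, fun h => h.1⟩
  have haU : a ∉ insert s K := by
    simp only [Finset.mem_insert, not_or]
    exact ⟨has.ne, ha⟩
  -- If `K` with `s` has become a sun, the partner of `s` must be `z`: the path `a, s, z` and a
  -- cover of the rest of the sun suffice.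
  by_cases hsun : IsSun G' (insert s K)
  · have h2 : 2 ≤ (insert s K).card := by
      rw [Finset.card_insert_of_notMem hs]
      have := hK.1.card_pos
      omega
    obtain ⟨w, hw, hsw, hc⟩ := hsun.exists_partner h2 (Finset.mem_insert_self s K)
    obtain rfl : w = z := hsw.2.1 rfl
    have hp := HasCover.of_arms (Arm.singleton has.symm) (Arm.singleton hsz)
      (by simp; rintro rfl; exact ha hz) (by simpa using has.ne.symm) (by simpa using hsz.ne)
    refine hp.of_sdiff ?_ ?_
    · convert hc.mono hle using 1
      ext x; simp; grind
    · intro x; simp; grind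
  -- If `s` is deleted, the suns are those of `K` minus fewer vertices, and `K` itself is not a sun.
  -- If `s` stays, at most one sun is new, the one containing `s`, and strictness of `K` absorbs it.
  · have hgood : Good G' (insert s K) := by
      have hKT : ∀ T ⊆ K, suns G' (K \ T) ⊆ suns G (K \ T) := by
        intro T hT C hC
        have hsub := suns_subset hC
        refine suns_congr hC fun u hu v hv => ?_
        rw [hagree u (Finset.mem_sdiff.1 (hsub hu)).1 v (Finset.mem_sdiff.1 hv).1]
      intro T hT
      by_cases hsT : s ∈ T
      · have e : insert s K \ T = K \ T.erase s := by
          ext x; simp; grind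
        have hTK : T.erase s ⊆ K := by
          intro x hx
          rw [Finset.mem_erase] at hx
          simpa [hx.1] using hT hx.2
        have h1 := Finset.card_erase_add_one hsT
        rw [e]
        refine (Finset.card_le_card (hKT _ hTK)).trans ?_
        rcases (T.erase s).eq_empty_or_nonempty with he | hne
        · have : suns G (K \ T.erase s) = ∅ := by
            rw [he, Finset.sdiff_empty, Finset.eq_empty_iff_forall_notMem]
            intro C hC
            have := comps_of_conn hK (suns_subset_comps hC)
            rw [Finset.mem_singleton] at this
            exact hns (this ▸ suns_isSun hC)
          simp [this]
        · have := hst _ hTK hne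
          omega
      · have hTK : T ⊆ K := fun x hx => by
          have := hT hx
          rw [Finset.mem_insert] at this
          rcases this with rfl | h
          · exact absurd hx hsT
          · exact h
        rcases T.eq_empty_or_nonempty with rfl | hT0
        · rw [Finset.sdiff_empty, Finset.card_empty, mul_zero, Nat.le_zero, Finset.card_eq_zero,
            Finset.eq_empty_iff_forall_notMem]
          intro C hC
          have hcl := suns_closed hC
          have hmeet : (K ∩ C).Nonempty := by
            obtain ⟨u, hu⟩ := suns_nonempty hC
            have := suns_subset hC hu
            rw [Finset.mem_insert] at this
            rcases this with rfl | h
            · exact ⟨z, by simp [hz, hcl u hu z (by simp [hz]) hsz']⟩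
            · exact ⟨u, by simp [h, hu]⟩
          have hKC : K ⊆ C := (hK.congr hagree).subset_of_closed (Finset.subset_insert s K) hcl hmeet
          have hsC : s ∈ C := hcl z (hKC hz) s (by simp) hsz'.symm
          have : C = insert s K := Finset.Subset.antisymm (suns_subset hC)
            (Finset.insert_subset hsC hKC)
          exact hsun (this ▸ suns_isSun hC)
        · have h1 := hst T hTK hT0
          have hsub : suns G' (insert s K \ T) ⊆ suns G (K \ T) ∪
              (suns G' (insert s K \ T)).filter (fun C => s ∈ C) := by
            intro C hC
            rw [Finset.mem_union, Finset.mem_filter]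
            by_cases hsC : s ∈ C
            · exact Or.inr ⟨hC, hsC⟩
            · refine Or.inl (hKT T hTK (suns_transfer hC ?_ ((suns_closed hC).mono ?_)))
              · intro x hx
                have := suns_subset hC hx
                simp only [Finset.mem_sdiff, Finset.mem_insert] at this ⊢
                refine ⟨this.1.resolve_left ?_, this.2⟩
                rintro rfl
                exact hsC hx
              · exact Finset.sdiff_subset_sdiff (Finset.subset_insert s K) (Finset.Subset.refl _)
          have hone : ((suns G' (insert s K \ T)).filter (fun C => s ∈ C)).card ≤ 1 := by
            rw [Finset.card_le_one]
            intro C hC D hD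
            rw [Finset.mem_filter] at hC hD
            exact comps_eq (suns_subset_comps hC.1) (suns_subset_comps hD.1) hC.2 hD.2
          have h2 := Finset.card_le_card hsub
          have h3 := Finset.card_union_le (suns G (K \ T))
            ((suns G' (insert s K \ T)).filter (fun C => s ∈ C))
          omega
    refine (ih G' hle hgood).insert_of_leaf hle (Finset.mem_insert_self s K) ?_ haU has
    intro v w hv hw
    rw [hv.2.1 rfl, hw.2.1 rfl]

/-- The corona of a graph of odd order violates `Good`. -/
theorem not_good_of_leaves {R : Finset V} (hRU : R ⊆ U) (hodd : Odd R.card)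
    (h1 : ∀ v ∈ R, ∃ l ∈ U, l ∉ R ∧ G.Adj v l ∧ ∀ y ∈ U, G.Adj l y → y = v)
    (h2 : ∀ v ∈ R, ∀ l ∈ U, ∀ l' ∈ U, l ∉ R → l' ∉ R → G.Adj v l → G.Adj v l' → l = l') :
    ¬ Good G U := by
  classical
  intro hgood
  obtain ⟨T, hT, hlt⟩ := exists_lt_card_criticalComps (G := G) hodd
  have h1' : ∀ v, ∃ l, v ∈ R → l ∈ U ∧ l ∉ R ∧ G.Adj v l ∧ ∀ y ∈ U, G.Adj l y → y = v := by
    intro v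
    by_cases hv : v ∈ R
    · obtain ⟨l, h⟩ := h1 v hv
      exact ⟨l, fun _ => h⟩
    · exact ⟨v, fun h => absurd h hv⟩
  choose p hp using h1'
  have hinj : Set.InjOn p R := by
    intro v hv w hw hvw
    exact (hp w hw).2.2.2 v (hRU hv) (hvw ▸ (hp v hv).2.2.1.symm)
  have hcrit : ∀ Q, Q ∈ criticalComps G (R \ T) ↔ Q ∈ comps G (R \ T) ∧ FactorCritical G Q := by
    simp [criticalComps]
  have hQR : ∀ Q ∈ criticalComps G (R \ T), Q ⊆ R := fun Q hQ =>
    ((mem_comps.1 ((hcrit Q).1 hQ).1).1).trans Finset.sdiff_subset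
  have hsing : ∀ t ∈ T, {p t} ∈ suns G (U \ T) := by
    intro t ht
    obtain ⟨k1, k2, k3, k4⟩ := hp t (hT ht)
    refine singleton_mem_suns ?_ ?_
    · rw [Finset.mem_sdiff]
      exact ⟨k1, fun h => k2 (hT h)⟩
    · intro y hy hpy
      rw [Finset.mem_sdiff] at hy
      exact hy.2 (k4 y hy.1 hpy ▸ ht)
  have hcor : ∀ Q ∈ criticalComps G (R \ T), Q ∪ Q.image p ∈ suns G (U \ T) := by
    intro Q hQ
    have hQR := hQR Q hQ
    obtain ⟨hQc, hQf⟩ := (hcrit Q).1 hQ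
    obtain ⟨hQs, hQconn, hQcl⟩ := mem_comps.1 hQc
    have hsubU : Q ∪ Q.image p ⊆ U \ T := by
      intro x hx
      rw [Finset.mem_union, Finset.mem_image] at hx
      rw [Finset.mem_sdiff]
      rcases hx with hx | ⟨q, hq, rfl⟩
      · exact ⟨hRU (hQR hx), (Finset.mem_sdiff.1 (hQs hx)).2⟩
      · obtain ⟨k1, k2, -, -⟩ := hp q (hQR hq)
        exact ⟨k1, fun h => k2 (hT h)⟩
    rw [mem_suns, mem_comps]
    refine ⟨⟨hsubU, ⟨?_, ?_⟩, ?_⟩, Or.inr ⟨Q, p, ⟨rfl, ?_, ?_, ?_, ?_⟩, hQf⟩⟩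
    · exact hQconn.1.mono Finset.subset_union_left
    · intro D hD hD0 hcl
      have hmeet : (Q ∩ D).Nonempty := by
        obtain ⟨x, hx⟩ := hD0
        have := hD hx
        rw [Finset.mem_union, Finset.mem_image] at this
        rcases this with h | ⟨q, hq, rfl⟩
        · exact ⟨x, by simp [h, hx]⟩
        · have := hcl _ hx q (by simp [hq]) (hp q (hQR hq)).2.2.1.symm
          exact ⟨q, by simp [hq, this]⟩
      have hQD : Q ⊆ D := hQconn.subset_of_closed Finset.subset_union_left hcl hmeet
      apply Finset.Subset.antisymm hD
      refine Finset.union_subset hQD ?_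
      intro x hx
      obtain ⟨q, hq, rfl⟩ := Finset.mem_image.1 hx
      exact hcl q (hQD hq) _ (Finset.mem_union_right _ hx) (hp q (hQR hq)).2.2.1
    · intro x hx y hy hxy
      rw [Finset.mem_union, Finset.mem_image] at hx
      rw [Finset.mem_sdiff] at hy
      rcases hx with hx | ⟨q, hq, rfl⟩
      · by_cases hyR : y ∈ R
        · exact Finset.mem_union_left _ (hQcl x hx y (by simp [hyR, hy.2]) hxy)
        · obtain ⟨k1, k2, k3, -⟩ := hp x (hQR hx)
          have := h2 x (hQR hx) y hy.1 (p x) k1 hyR k2 hxy k3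
          rw [this]
          exact Finset.mem_union_right _ (Finset.mem_image_of_mem p hx)
      · have := (hp q (hQR hq)).2.2.2 y hy.1 hxy
        rw [this]
        exact Finset.mem_union_left _ hq
    · intro v hv hpv
      exact (hp v (hQR hv)).2.1 (hQR hpv)
    · exact hinj.mono hQR
    · intro v hv
      exact (hp v (hQR hv)).2.2.1
    · intro v hv y hy
      exact (hp v (hQR hv)).2.2.2 y (Finset.mem_sdiff.1 (hsubU hy)).1
  -- Deleting `T` isolates its `|T|` pendant vertices and turns each of the more than `|T|`
  -- factor-critical components into a sun, for a total above `2|T|`.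
  have hsub : T.image (fun t => ({p t} : Finset V)) ∪
      (criticalComps G (R \ T)).image (fun Q => Q ∪ Q.image p) ⊆ suns G (U \ T) := by
    intro C hC
    rw [Finset.mem_union, Finset.mem_image, Finset.mem_image] at hC
    rcases hC with ⟨t, ht, rfl⟩ | ⟨Q, hQ, rfl⟩
    · exact hsing t ht
    · exact hcor Q hQ
  have hcoreq : ∀ Q ∈ criticalComps G (R \ T), (Q ∪ Q.image p) ∩ R = Q := by
    intro Q hQ
    have hQR := hQR Q hQ
    ext x
    simp only [Finset.mem_inter, Finset.mem_union, Finset.mem_image]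
    constructor
    · rintro ⟨h | ⟨q, hq, rfl⟩, hR⟩
      · exact h
      · exact absurd hR (hp q (hQR hq)).2.1
    · exact fun h => ⟨Or.inl h, hQR h⟩
  have hle := Finset.card_le_card hsub
  rw [Finset.card_union_of_disjoint, Finset.card_image_of_injOn, Finset.card_image_of_injOn] at hle
  · have := hgood T (hT.trans hRU)
    omega
  · intro Q hQ Q' hQ' h
    have h : Q ∪ Q.image p = Q' ∪ Q'.image p := h
    rw [← hcoreq Q hQ, ← hcoreq Q' hQ', h]
  · intro t ht t' ht' h
    exact hinj (hT ht) (hT ht') (by simpa using h)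
  · rw [Finset.disjoint_left]
    intro C hC hC'
    obtain ⟨t, ht, rfl⟩ := Finset.mem_image.1 hC
    obtain ⟨Q, hQ, hQ'⟩ := Finset.mem_image.1 hC'
    have h := hcoreq Q hQ
    have hQ' : Q ∪ Q.image p = {p t} := hQ'
    rw [hQ'] at h
    obtain ⟨q, hq⟩ := (mem_comps.1 ((hcrit Q).1 hQ).1).2.1.1
    rw [← h, Finset.mem_inter, Finset.mem_singleton] at hq
    exact (hp t (hT ht)).2.1 (hq.1 ▸ hq.2)

end Kaneko

/-! ### Kaneko's criterion: only suns remain -/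

section Kaneko

variable {V : Type*} [DecidableEq V] {G G' : SimpleGraph V} {U S : Finset V}

/-- A sun on at least two vertices can be presented so that no pendant vertex has a neighbour in
`S`, unless the sun can be used by two vertices of `S`. -/
theorem exists_core_of_not_hasCover [Nonempty V] (hG : Good G U) (hst : Strict G U) (hS : S ⊆ U)
    (hcard : (suns G (U \ S)).card + 1 = 2 * S.card) (hrest : HasCover G (rest G U S))
    (hno : ¬ HasCover G U)
    (hleaf : ∀ s ∈ S, ∃ a, {a} ∈ suns G (U \ S) ∧ nbrs G S {a} = {s})
    {D : Finset V} (hD : D ∈ suns G (U \ S)) (h2 : 2 ≤ D.card) :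
    ∃ R p, IsCorona G D R p ∧ FactorCritical G R ∧ ∀ v ∈ R, ∀ s ∈ S, ¬ G.Adj s (p v) := by
  have hE : ∀ s ∈ S, ∃ E ∈ suns G (U \ S), E ≠ D ∧ nbrs G S E = {s} := by
    intro s hs
    obtain ⟨a, ha, ha'⟩ := hleaf s hs
    refine ⟨{a}, ha, ?_, ha'⟩
    rintro rfl
    simp at h2
  have hdis : ∀ X ∈ suns G (U \ S), X ≠ D → Disjoint X D := fun X hX h => suns_disjoint hX hD h
  rcases suns_isSun hD with ⟨v, rfl⟩ | ⟨R, p, hc, hR⟩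
  · simp at h2
  by_cases hatt : ∀ v ∈ R, ∀ s ∈ S, ¬ G.Adj s (p v)
  · exact ⟨R, p, hc, hR, hatt⟩
  push Not at hatt
  obtain ⟨v, hv, s₀, hs₀, hsv⟩ := hatt
  have hzD := hc.mem_leaf hv
  have hA : (nbrs G S {p v}).Nonempty := ⟨s₀, mem_nbrs.2 ⟨hs₀, p v, by simp, hsv⟩⟩
  -- When `S` meets `D` only at the pendant vertex `p v` and the core is large, two vertices of `S`
  -- can share `p v`, the rest of `D` having its own cover. When `S` also sees another vertex, one
  -- arm enters at `p v` and another elsewhere. Both contradict `hno`.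
  rcases (nbrs G S (D.erase (p v))).eq_empty_or_nonempty with hB | hB
  · have honly : ∀ x ∈ D, x ≠ p v → ∀ s ∈ S, ¬ G.Adj s x := by
      intro x hx hxv s hs hsx
      have : s ∈ nbrs G S (D.erase (p v)) := mem_nbrs.2 ⟨hs, x, by simp [hx, hxv], hsx⟩
      rw [hB] at this
      simp at this
    by_cases hR2 : 2 ≤ R.card
    · exfalso
      refine hno (hasCover_of_split hG hst hS hcard hrest hD hA hA ?_ ?_ ?_)
      · rw [Finset.union_self]
        ext s
        rw [mem_nbrs, mem_nbrs]
        constructor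
        · rintro ⟨hs, z, hz, hsz⟩
          obtain rfl : z = p v := by simpa using hz
          exact ⟨hs, _, hzD, hsz⟩
        · rintro ⟨hs, z, hz, hsz⟩
          refine ⟨hs, z, ?_, hsz⟩
          by_contra hne
          exact honly z hz (by simpa using hne) s hs hsz
      · exact fun s hs _ => hE s (mem_nbrs.1 hs).1
      · intro s hs t ht hst X hX Y hY hXY hXD hYD hsX htY
        obtain ⟨hsS, z, hz, hsz⟩ := mem_nbrs.1 hs
        obtain rfl : z = p v := by simpa using hz
        obtain ⟨htS, z', hz', htz⟩ := mem_nbrs.1 ht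
        obtain rfl : z' = p v := by simpa using hz'
        obtain ⟨-, x, hx, hsx⟩ := mem_nbrs.1 hsX
        obtain ⟨-, y, hy, hty⟩ := mem_nbrs.1 htY
        exact hasCover_of_arms_through hzD hsz htz hst (notMem_of_mem_suns hD hsS)
          (notMem_of_mem_suns hD htS) ((suns_isSun hX).arm hx hsx) ((suns_isSun hY).arm hy hty)
          (notMem_of_mem_suns hX hsS) (notMem_of_mem_suns hX htS) (notMem_of_mem_suns hY hsS)
          (notMem_of_mem_suns hY htS) (suns_disjoint hX hY hXY) (hdis X hX hXD) (hdis Y hY hYD)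
          (hc.hasCover_erase_leaf hR hv hR2)
    -- Here `D` is a `K₂`; core and pendant vertex exchange roles, so that the attached vertex
    -- becomes the core.
    · have hRv : R = {v} := by
        have : R.card = 1 := by
          have := hR.1.card_pos
          omega
        obtain ⟨w, rfl⟩ := Finset.card_eq_one.1 this
        rw [Finset.mem_singleton] at hv
        rw [hv]
      have hDv : D = {v, p v} := by
        rw [hc.eq_union, hRv]
        ext; simp
      have hvp := hc.adj v hv
      refine ⟨{p v}, fun _ => v, ⟨?_, ?_, ?_, ?_, ?_⟩, ⟨by simp, ?_⟩, ?_⟩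
      · rw [hDv]; ext; simp; tauto
      · simpa using hvp.ne
      · simp
      · simpa using hvp.symm
      · intro w hw y hy hvy
        obtain rfl : w = p v := by simpa using hw
        rw [hDv] at hy
        simp only [Finset.mem_insert, Finset.mem_singleton] at hy
        rcases hy with rfl | rfl
        · exact absurd rfl hvy.ne
        · rfl
      · intro w hw
        obtain rfl : w = p v := by simpa using hw
        simpa using HasMatching.empty
      · intro _ _ s hs hsv
        exact honly v (hc.mem_core hv) (hc.ne_leaf hv hv) s hs hsv
  · exfalso
    refine hno (hasCover_of_split hG hst hS hcard hrest hD hA hB ?_ ?_ ?_)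
    · ext s
      rw [Finset.mem_union, mem_nbrs, mem_nbrs, mem_nbrs]
      constructor
      · rintro (⟨hs, z, hz, hsz⟩ | ⟨hs, z, hz, hsz⟩)
        · obtain rfl : z = p v := by simpa using hz
          exact ⟨hs, _, hzD, hsz⟩
        · exact ⟨hs, z, Finset.mem_of_mem_erase hz, hsz⟩
      · rintro ⟨hs, z, hz, hsz⟩
        by_cases hzv : z = p v
        · exact Or.inl ⟨hs, z, by simpa using hzv, hsz⟩
        · exact Or.inr ⟨hs, z, by simp [hz, hzv], hsz⟩
    · exact fun s hs _ => hE s (mem_nbrs.1 hs).1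
    · intro s hs t ht hst X hX Y hY hXY hXD hYD hsX htY
      obtain ⟨hsS, z, hz, hsz⟩ := mem_nbrs.1 hs
      obtain rfl : z = p v := by simpa using hz
      obtain ⟨htS, z', hz', htz⟩ := mem_nbrs.1 ht
      rw [Finset.mem_erase] at hz'
      obtain ⟨-, x, hx, hsx⟩ := mem_nbrs.1 hsX
      obtain ⟨-, y, hy, hty⟩ := mem_nbrs.1 htY
      exact hc.hasCover_of_arms hR hv hz'.2 hz'.1 hsz htz hst (notMem_of_mem_suns hD hsS)
        (notMem_of_mem_suns hD htS) ((suns_isSun hX).arm hx hsx) ((suns_isSun hY).arm hy hty)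
        (notMem_of_mem_suns hX hsS) (notMem_of_mem_suns hX htS) (notMem_of_mem_suns hY hsS)
        (notMem_of_mem_suns hY htS) (suns_disjoint hX hY hXY) (hdis X hX hXD) (hdis Y hY hYD)

/-- If `U \ S` has `2 |S| - 1` components, all of them suns, then `U` has a cover. -/
theorem hasCover_of_rest_eq_empty [Nonempty V] (hU : Conn G U) (hG : Good G U) (hst : Strict G U)
    (hS : S ⊆ U) (hcard : (suns G (U \ S)).card + 1 = 2 * S.card) (hr : rest G U S = ∅) :
    HasCover G U := by
  classical
  by_contra hno
  have hrest : HasCover G (rest G U S) := by rw [hr]; exact .empty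
  have hS0 : S.Nonempty := by
    rw [← Finset.card_pos]
    omega
  -- A one-vertex sun with two neighbours in `S` could join the arms of two vertices of `S`.
  have huniq : ∀ a s, {a} ∈ suns G (U \ S) → s ∈ nbrs G S {a} → nbrs G S {a} = {s} := by
    intro a s ha hs
    by_contra hne
    have hB : ((nbrs G S {a}).erase s).Nonempty := by
      rw [Finset.nonempty_iff_ne_empty]
      intro he
      rw [Finset.erase_eq_empty_iff] at he
      rcases he with he | he
      · rw [he] at hs; simp at hs
      · exact hne he
    refine hno (hasCover_of_split hG hst hS hcard hrest ha (Finset.singleton_nonempty s) hB ?_ ?_ ?_)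
    · ext t; simp; grind
    · intro t ht ht'
      obtain rfl : t = s := by simpa using ht
      simp at ht'
    · intro s' hs' t ht hst X hX Y hY hXY hXD hYD hsX htY
      obtain rfl : s' = s := by simpa using hs'
      have ht := Finset.mem_of_mem_erase ht
      obtain ⟨hsS, z, hz, hsz⟩ := mem_nbrs.1 hs
      obtain rfl : z = a := by simpa using hz
      obtain ⟨htS, z', hz', htz⟩ := mem_nbrs.1 ht
      obtain rfl : z' = z := by simpa using hz'
      obtain ⟨-, x, hx, hsx⟩ := mem_nbrs.1 hsX
      obtain ⟨-, y, hy, hty⟩ := mem_nbrs.1 htY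
      exact hasCover_of_arms_through hz hsz htz hst (notMem_of_mem_suns ha hsS)
        (notMem_of_mem_suns ha htS) ((suns_isSun hX).arm hx hsx) ((suns_isSun hY).arm hy hty)
        (notMem_of_mem_suns hX hsS) (notMem_of_mem_suns hX htS) (notMem_of_mem_suns hY hsS)
        (notMem_of_mem_suns hY htS) (suns_disjoint hX hY hXY) (suns_disjoint hX ha hXD)
        (suns_disjoint hY ha hYD) (by simpa using HasCover.empty)
  -- Let `s` receive a single sun. With at least two vertices it would have a cover together with
  -- `s`, so it is one vertex, and by `huniq` it is pendant at `s`.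
  have hleaf : ∀ s ∈ S, ∃ a, {a} ∈ suns G (U \ S) ∧ nbrs G S {a} = {s} := by
    intro s hs
    obtain ⟨f, hf, hf2, C₀, hC₀, hfib⟩ := exists_assignment_alone hG hst hS hcard hs
    have hfC₀ : f C₀ = s := by
      have : C₀ ∈ (suns G (U \ S)).filter fun C => f C = s := by rw [hfib]; simp
      exact (Finset.mem_filter.1 this).2
    have hs' := hf C₀ hC₀
    rw [hfC₀] at hs'
    by_cases h2 : 2 ≤ C₀.card
    · exfalso
      refine hno (hasCover_of_assignment hS f hf {s} (by simpa using hs)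
        (fun t ht hts => hf2 t ht (by simpa using hts)) ?_)
      have e : ((suns G (U \ S)).filter fun C => f C ∈ ({s} : Finset V)) = {C₀} := by
        rw [← hfib]
        ext; simp
      rw [e, hr]
      obtain ⟨-, z, hz, hsz⟩ := mem_nbrs.1 hs'
      have := (suns_isSun hC₀).hasCover_insert h2 hz hsz (notMem_of_mem_suns hC₀ hs)
      convert this using 1
      ext; simp
    · have : C₀.card = 1 := by
        have := (suns_nonempty hC₀).card_pos
        omega
      obtain ⟨a, rfl⟩ := Finset.card_eq_one.1 this
      exact ⟨a, hC₀, huniq a s hC₀ hs'⟩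
  have hnbr : ∀ C ∈ suns G (U \ S), (nbrs G S C).Nonempty := by
    intro C hC
    have hCU : C ≠ U := by
      rintro rfl
      obtain ⟨s, hs⟩ := hS0
      exact notMem_of_mem_suns hC hs (hS hs)
    obtain ⟨x, hx, y, hy, hyC, hxy⟩ := hU.exists_adj
      ((suns_subset hC).trans Finset.sdiff_subset) (suns_nonempty hC) hCU
    refine ⟨y, mem_nbrs.2 ⟨?_, x, hx, hxy.symm⟩⟩
    by_contra hyS
    exact hyC (suns_closed hC x hx y (by simp [hy, hyS]) hxy)
  -- Two suns attached only to `s` would both survive the deletion of `{s}`, against strictness.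
  have hpend : ∀ s ∈ S, ∀ C ∈ suns G (U \ S), ∀ D ∈ suns G (U \ S), nbrs G S C = {s} →
      nbrs G S D = {s} → C = D := by
    intro s hs C hC D hD hCs hDs
    by_contra hCD
    have hsub : {C, D} ⊆ suns G (U \ {s}) := by
      intro E hE
      simp only [Finset.mem_insert, Finset.mem_singleton] at hE
      rcases hE with rfl | rfl
      · exact suns_of_nbrs_subset (by simpa using hs) hC hCs.le
      · exact suns_of_nbrs_subset (by simpa using hs) hD hDs.le
    have h1 := Finset.card_le_card hsub
    have h2 := hst {s} (by simpa using hS hs) (by simp)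
    rw [Finset.card_pair hCD] at h1
    rw [Finset.card_singleton] at h2
    omega
  -- Each sun contributes an odd piece `ρ` of the core of `U`: a one-vertex sun contributes its
  -- neighbour in `S`, a larger sun its own core. The remaining vertices of the sun are pendant in
  -- all of `U`.
  have hcore : ∀ C ∈ suns G (U \ S), ∃ ρ : Finset V, Odd ρ.card ∧
      (∀ v ∈ ρ, v ∈ C ∨ v ∈ S ∧ nbrs G S C = {v}) ∧
      (∀ v ∈ ρ, ∃ l ∈ C, l ∉ ρ ∧ G.Adj v l ∧ ∀ y ∈ U, G.Adj l y → y = v) ∧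
      (∀ x ∈ C, x ∉ ρ → ∀ y ∈ U, ∀ y' ∈ U, G.Adj x y → G.Adj x y' → y = y') ∧
      (C.card = 1 → nbrs G S C ⊆ ρ) := by
    intro C hC
    have hCU := (suns_subset hC).trans Finset.sdiff_subset
    by_cases h2 : 2 ≤ C.card
    · obtain ⟨R, p, hc, hR, hatt⟩ :=
        exists_core_of_not_hasCover hG hst hS hcard hrest hno hleaf hC h2
      have hpl : ∀ v ∈ R, ∀ y ∈ U, G.Adj (p v) y → y = v := by
        intro v hv y hy hvy
        refine hc.leaf v hv y ?_ hvy
        have hyS : y ∉ S := fun h => hatt v hv y h hvy.symm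
        exact suns_closed hC _ (hc.mem_leaf hv) y (by simp [hy, hyS]) hvy
      refine ⟨R, hR.odd, fun v hv => Or.inl (hc.mem_core hv), ?_, ?_, by omega⟩
      · intro v hv
        exact ⟨p v, hc.mem_leaf hv, hc.notMem v hv, hc.adj v hv, hpl v hv⟩
      · intro x hx hxR y hy y' hy' hxy hxy'
        obtain ⟨v, hv, rfl | rfl⟩ := hc.exists_eq hx
        · exact absurd hv hxR
        · rw [hpl v hv y hy hxy, hpl v hv y' hy' hxy']
    · have : C.card = 1 := by
        have := (suns_nonempty hC).card_pos
        omega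
      obtain ⟨a, rfl⟩ := Finset.card_eq_one.1 this
      obtain ⟨s, hs⟩ := hnbr _ hC
      have hs1 := huniq a s hC hs
      obtain ⟨hsS, z, hz, hsz⟩ := mem_nbrs.1 hs
      obtain rfl : z = a := by simpa using hz
      have hzl : ∀ y ∈ U, G.Adj z y → y = s := by
        intro y hy hzy
        by_cases hyS : y ∈ S
        · have : y ∈ nbrs G S {z} := mem_nbrs.2 ⟨hyS, z, hz, hzy.symm⟩
          rw [hs1] at this
          simpa using this
        · have := suns_closed hC z hz y (by simp [hy, hyS]) hzy
          exact absurd (by simpa using this : y = z) hzy.ne.symm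
      refine ⟨{s}, by simp, ?_, ?_, ?_, fun _ => hs1.le⟩
      · intro v hv
        obtain rfl : v = s := by simpa using hv
        exact Or.inr ⟨hsS, hs1⟩
      · intro v hv
        obtain rfl : v = s := by simpa using hv
        exact ⟨z, hz, by simpa using hsz.ne.symm, hsz, hzl⟩
      · intro x hx _ y hy y' hy' hxy hxy'
        obtain rfl : x = z := by simpa using hx
        rw [hzl y hy hxy, hzl y' hy' hxy']
  have hcore' : ∀ C, ∃ ρ : Finset V, C ∈ suns G (U \ S) → Odd ρ.card ∧
      (∀ v ∈ ρ, v ∈ C ∨ v ∈ S ∧ nbrs G S C = {v}) ∧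
      (∀ v ∈ ρ, ∃ l ∈ C, l ∉ ρ ∧ G.Adj v l ∧ ∀ y ∈ U, G.Adj l y → y = v) ∧
      (∀ x ∈ C, x ∉ ρ → ∀ y ∈ U, ∀ y' ∈ U, G.Adj x y → G.Adj x y' → y = y') ∧
      (C.card = 1 → nbrs G S C ⊆ ρ) := by
    intro C
    by_cases hC : C ∈ suns G (U \ S)
    · obtain ⟨ρ, hρ⟩ := hcore C hC
      exact ⟨ρ, fun _ => hρ⟩
    · exact ⟨∅, fun h => absurd h hC⟩
  choose ρ hρ using hcore'
  have hdisj : ∀ C ∈ suns G (U \ S), ∀ D ∈ suns G (U \ S), ∀ v, v ∈ ρ C → v ∈ ρ D → C = D := by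
    intro C hC D hD v hvC hvD
    rcases (hρ C hC).2.1 v hvC with h | h
    · rcases (hρ D hD).2.1 v hvD with h' | h'
      · exact comps_eq (suns_subset_comps hC) (suns_subset_comps hD) h h'
      · exact absurd h (notMem_of_mem_suns hC h'.1)
    · rcases (hρ D hD).2.1 v hvD with h' | h'
      · exact absurd h' (notMem_of_mem_suns hD h.1)
      · exact hpend v h.1 C hC D hD h.2 h'.2
  set R := (suns G (U \ S)).biUnion ρ with hR
  have hmemR : ∀ x, x ∈ R ↔ ∃ C ∈ suns G (U \ S), x ∈ ρ C := by
    intro x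
    rw [hR, Finset.mem_biUnion]
  have hSR : S ⊆ R := by
    intro s hs
    obtain ⟨a, ha, has⟩ := hleaf s hs
    exact (hmemR s).2 ⟨{a}, ha, (hρ _ ha).2.2.2.2 (by simp) (by rw [has]; simp)⟩
  have hnotR : ∀ C ∈ suns G (U \ S), ∀ x ∈ C, x ∉ ρ C → x ∉ R := by
    intro C hC x hx hxρ hxR
    obtain ⟨D, hD, hxD⟩ := (hmemR x).1 hxR
    rcases (hρ D hD).2.1 x hxD with h | h
    · have := comps_eq (suns_subset_comps hC) (suns_subset_comps hD) hx h
      exact hxρ (this ▸ hxD)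
    · exact notMem_of_mem_suns hC h.1 hx
  have hsunU : ∀ C ∈ suns G (U \ S), C ⊆ U := fun C hC =>
    (suns_subset hC).trans Finset.sdiff_subset
  refine not_good_of_leaves (G := G) (U := U) (R := R) ?_ ?_ ?_ ?_ hG
  · intro x hx
    obtain ⟨C, hC, hxC⟩ := (hmemR x).1 hx
    rcases (hρ C hC).2.1 x hxC with h | h
    · exact hsunU C hC h
    · exact hS h.1
  -- An odd number `2|S| - 1` of disjoint pieces of odd size makes `R` odd.
  · rw [hR, Finset.card_biUnion (fun C hC D hD hCD => by
      rw [Function.onFun, Finset.disjoint_left]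
      exact fun v hv hv' => hCD (hdisj C hC D hD v hv hv')), Finset.odd_sum_iff_odd_card_odd,
      Finset.filter_true_of_mem fun C hC => (hρ C hC).1]
    rw [Nat.odd_iff]
    omega
  · intro v hv
    obtain ⟨C, hC, hvC⟩ := (hmemR v).1 hv
    obtain ⟨l, hl, hlρ, hvl, hly⟩ := (hρ C hC).2.2.1 v hvC
    exact ⟨l, hsunU C hC hl, hnotR C hC l hl hlρ, hvl, hly⟩
  · intro v hv l hl l' hl' hlR hl'R hvl hvl'
    have hvU : v ∈ U := by
      obtain ⟨D, hD, hvD⟩ := (hmemR v).1 hv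
      rcases (hρ D hD).2.1 v hvD with h | h
      · exact hsunU D hD h
      · exact hS h.1
    -- A vertex outside `R` has at most one neighbour, so it is isolated once that neighbour `v` is
    -- deleted; two of them at `v` would contradict strictness at `{v}`.
    have hone : ∀ x ∈ U, x ∉ R → G.Adj v x → {x} ∈ suns G (U \ {v}) := by
      intro x hx hxR hvx
      have hxS : x ∉ S := fun h => hxR (hSR h)
      have : ∃ C ∈ suns G (U \ S), x ∈ C := by
        by_contra hcon
        push Not at hcon
        have : x ∈ rest G U S := mem_rest.2 ⟨⟨hx, hxS⟩, hcon⟩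
        rw [hr] at this
        simp at this
      obtain ⟨C, hC, hxC⟩ := this
      have hxρ : x ∉ ρ C := fun h => hxR ((hmemR x).2 ⟨C, hC, h⟩)
      refine singleton_mem_suns (by simp [hx, hvx.ne.symm]) fun y hy hxy => ?_
      rw [Finset.mem_sdiff, Finset.mem_singleton] at hy
      exact hy.2 ((hρ C hC).2.2.2.1 x hxC hxρ y hy.1 v hvU hxy hvx.symm)
    by_contra hne
    have hsub : {{l}, {l'}} ⊆ suns G (U \ {v}) := by
      intro E hE
      simp only [Finset.mem_insert, Finset.mem_singleton] at hE
      rcases hE with rfl | rfl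
      · exact hone l hl hlR hvl
      · exact hone l' hl' hl'R hvl'
    have h1 := Finset.card_le_card hsub
    have h2 := hst {v} (by simpa using hvU) (by simp)
    rw [Finset.card_pair (by simpa using hne)] at h1
    rw [Finset.card_singleton] at h2
    omega

end Kaneko

/-! ### Kaneko's criterion: the induction -/

section Kaneko

variable {V : Type*} [DecidableEq V]

/-- Kaneko's theorem: if deleting any set `S` of vertices leaves at most `2 |S|` sun components,
then the vertices can be partitioned into paths with at least three vertices. -/
theorem hasCover_of_good [Fintype V] (G : SimpleGraph V) (U : Finset V) (hG : Good G U) :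
    HasCover G U := by
  classical
  induction hn : U.card + G.edgeSet.ncard using Nat.strong_induction_on generalizing G U with
  | _ n ih =>
  subst hn
  have ihU : ∀ G' ≤ G, ∀ U' : Finset V, U'.card < U.card → Good G' U' → HasCover G' U' := by
    intro G' hle U' hU' hG'
    refine ih _ ?_ G' U' hG' rfl
    have := Set.ncard_le_ncard (SimpleGraph.edgeSet_mono hle) (Set.toFinite _)
    omega
  rcases U.eq_empty_or_nonempty with rfl | hU0
  · exact .empty
  have : Nonempty V := ⟨hU0.choose⟩
  by_cases hU : Conn G U
  swap
  · have : ∃ D ⊆ U, D.Nonempty ∧ Closed G U D ∧ D ≠ U := by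
      by_contra hcon
      push Not at hcon
      exact hU ⟨hU0, hcon⟩
    obtain ⟨D, hDU, hD0, hcl, hne⟩ := this
    have h1 : D.card < U.card := Finset.card_lt_card (Finset.ssubset_iff_subset_ne.2 ⟨hDU, hne⟩)
    have h2 : (U \ D).card < U.card := by
      have := Finset.card_sdiff_add_card_eq_card hDU
      have := hD0.card_pos
      omega
    exact (ihU G le_rfl D h1 (hG.of_closed hDU hcl)).of_sdiff
      (ihU G le_rfl _ h2 (hG.of_closed Finset.sdiff_subset hcl.sdiff)) hDU
  have hrestlt : ∀ S ⊆ U, S.Nonempty → (rest G U S).card < U.card := by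
    intro S hS hS0
    apply Finset.card_lt_card
    rw [Finset.ssubset_iff_subset_ne]
    refine ⟨rest_subset, fun he => ?_⟩
    obtain ⟨s, hs⟩ := hS0
    have := hS hs
    rw [← he] at this
    exact (mem_rest.1 this).1.2 hs
  by_cases hst : Strict G U
  swap
  -- Equality for some `S`: each of its vertices takes two suns, and `rest` inherits `Good` because
  -- the suns of `U \ S` already use up `2|S|`.
  · have : ∃ S ⊆ U, S.Nonempty ∧ 2 * S.card ≤ (suns G (U \ S)).card := by
      by_contra hcon
      push Not at hcon
      exact hst hcon
    obtain ⟨S, hS, hS0, hc⟩ := this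
    have hcard := le_antisymm (hG S hS) hc
    refine hasCover_of_card_eq_two_mul hG hS hcard (ihU G le_rfl _ (hrestlt S hS hS0) ?_)
    intro T hT
    have h1 := card_suns_rest_add hT
    have h2 := hG (S ∪ T) (Finset.union_subset hS (hT.trans rest_subset))
    have h3 := Finset.card_union_le S T
    omega
  by_cases htight : ∃ S ⊆ U, S.Nonempty ∧ (suns G (U \ S)).card + 1 = 2 * S.card
  swap
  · push Not at htight
    have hnt : ∀ S ⊆ U, S.Nonempty → (suns G (U \ S)).card + 2 ≤ 2 * S.card := by
      intro S hS hS0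
      have := hst S hS hS0
      have := htight S hS hS0
      omega
    obtain ⟨x, hx⟩ := hU0
    have hxU : {x} ≠ U := by
      rintro rfl
      have h1 : {x} ∈ suns G {x} := singleton_mem_suns (by simp) fun y hy hxy => by
        rw [Finset.mem_singleton] at hy
        exact hxy.ne hy.symm
      have h2 := hG ∅ (by simp)
      rw [Finset.sdiff_empty, Finset.card_empty, mul_zero, Nat.le_zero, Finset.card_eq_zero] at h2
      rw [h2] at h1
      simp at h1
    obtain ⟨x', hx', y, hy, -, hxy⟩ := hU.exists_adj (by simpa using hx) (by simp) hxU
    obtain rfl : x' = x := by simpa using hx'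
    refine (ih _ ?_ _ U (Good.deleteEdge hU hnt hx hy hxy) rfl).mono (SimpleGraph.deleteEdges_le _)
    have : (G.deleteEdges {s(x', y)}).edgeSet.ncard < G.edgeSet.ncard := by
      refine Set.ncard_lt_ncard ?_ (Set.toFinite _)
      rw [SimpleGraph.edgeSet_deleteEdges]
      refine ⟨Set.sdiff_subset, fun hsub => ?_⟩
      have := hsub (show s(x', y) ∈ G.edgeSet from hxy)
      simp at this
    omega
  -- Maximality is what makes `rest` strict: a nonempty `T` with `2|T|` suns in `rest` would make `S
  -- ∪ T` a larger set with one sun missing.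
  obtain ⟨S, hSm, hmax⟩ := Finset.exists_max_image
    (U.powerset.filter fun S => S.Nonempty ∧ (suns G (U \ S)).card + 1 = 2 * S.card) Finset.card (by
      obtain ⟨S, h1, h2⟩ := htight
      exact ⟨S, by simpa only [Finset.mem_filter, Finset.mem_powerset] using ⟨h1, h2⟩⟩)
  simp only [Finset.mem_filter, Finset.mem_powerset] at hSm hmax
  obtain ⟨hS, hS0, hcard⟩ := hSm
  rcases (rest G U S).eq_empty_or_nonempty with hr | ⟨x, hx⟩
  · exact hasCover_of_rest_eq_empty hU hG hst hS hcard hr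
  have hrest_good : Good G (rest G U S) := by
    intro T hT
    have h1 := card_suns_rest_add hT
    have h2 := hst (S ∪ T) (Finset.union_subset hS (hT.trans rest_subset))
      (hS0.mono Finset.subset_union_left)
    have h3 := Finset.card_union_le S T
    omega
  have hrest_strict : Strict G (rest G U S) := by
    intro T hT hT0
    have h1 := card_suns_rest_add hT
    have hU' := Finset.union_subset hS (hT.trans rest_subset)
    have hne := hS0.mono (Finset.subset_union_left (s₂ := T))
    have h2 := hst (S ∪ T) hU' hne
    have h3 : (S ∪ T).card = S.card + T.card := by
      apply Finset.card_union_of_disjoint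
      rw [Finset.disjoint_left]
      exact fun y hy hyT => (mem_rest.1 (hT hyT)).1.2 hy
    have h4 := hT0.card_pos
    have h5 : (suns G (U \ (S ∪ T))).card + 1 ≠ 2 * (S ∪ T).card := by
      intro he
      have := hmax (S ∪ T) ⟨hU', hne, he⟩
      omega
    omega
  have hx' := mem_rest.1 hx
  obtain ⟨K, hK, hxK⟩ := exists_mem_comps (G := G) (U := U \ S) (x := x) (by simpa using hx'.1)
  obtain ⟨hKU, hKconn, hKcl⟩ := mem_comps.1 hK
  have hKsun : ¬ IsSun G K := fun h => hx'.2 K (mem_suns.2 ⟨hK, h⟩) hxK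
  have hKrest : K ⊆ rest G U S := by
    intro y hy
    refine mem_rest.2 ⟨by simpa using hKU hy, fun C hC hyC => ?_⟩
    have := comps_eq (suns_subset_comps hC) hK hyC hy
    exact hKsun (this ▸ suns_isSun hC)
  have hrestU : rest G U S ⊆ U \ S := fun y hy => by simpa using (mem_rest.1 hy).1
  have hKclr : Closed G (rest G U S) K := hKcl.mono hrestU
  have hKstrict : Strict G K := fun T hT hT0 =>
    (Finset.card_le_card (suns_subset_suns_of_closed hKrest hKclr)).trans_lt
      (hrest_strict T (hT.trans hKrest) hT0)
  have hKS : ∀ s ∈ S, s ∉ K := fun s hs h => (Finset.mem_sdiff.1 (hKU h)).2 hs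
  obtain ⟨z, hz, s₀, hs₀U, hs₀K, hzs⟩ := hU.exists_adj (hKU.trans Finset.sdiff_subset) hKconn.1 (by
    rintro rfl
    obtain ⟨s, hs⟩ := hS0
    exact hKS s hs (hS hs))
  have hs₀ : s₀ ∈ S := by
    by_contra h
    exact hs₀K (hKcl z hz s₀ (by simp [hs₀U, h]) hzs)
  -- The vertex that gets only one sun is chosen to be `s₀`, a neighbour of the non-sun component
  -- `K`.
  obtain ⟨f, hf, hf2, C₀, hC₀, hfib⟩ := exists_assignment_alone hG hst hS hcard hs₀
  have hfC₀ : f C₀ = s₀ := by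
    have : C₀ ∈ (suns G (U \ S)).filter fun C => f C = s₀ := by rw [hfib]; simp
    exact (Finset.mem_filter.1 this).2
  have hs' := hf C₀ hC₀
  rw [hfC₀] at hs'
  obtain ⟨-, w, hw, hsw⟩ := mem_nbrs.1 hs'
  have hC₀rest : ∀ y ∈ C₀, y ∉ rest G U S := fun y hy h => (mem_rest.1 h).2 C₀ hC₀ hy
  have hs₀rest : s₀ ∉ rest G U S := fun h => (mem_rest.1 h).1.2 hs₀
  refine hasCover_of_assignment hS f hf {s₀} (by simpa using hs₀)
    (fun t ht hts => hf2 t ht (by simpa using hts)) ?_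
  have e : ((suns G (U \ S)).filter fun C => f C ∈ ({s₀} : Finset V)) = {C₀} := by
    rw [← hfib]
    ext; simp
  rw [e]
  have e2 : rest G U S ∪ ({s₀} ∪ ({C₀} : Finset (Finset V)).biUnion id) =
      rest G U S ∪ insert s₀ C₀ := by
    ext; simp
  rw [e2]
  by_cases h2 : 2 ≤ C₀.card
  · refine (ihU G le_rfl _ (hrestlt S hS hS0) hrest_good).union
      ((suns_isSun hC₀).hasCover_insert h2 hw hsw (notMem_of_mem_suns hC₀ hs₀)) ?_
    rw [Finset.disjoint_right]
    intro y hy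
    rcases Finset.mem_insert.1 hy with rfl | hy
    · exact hs₀rest
    · exact hC₀rest y hy
  · have : C₀.card = 1 := by
      have := (suns_nonempty hC₀).card_pos
      omega
    obtain ⟨a, rfl⟩ := Finset.card_eq_one.1 this
    obtain rfl : w = a := by simpa using hw
    have hwrest := hC₀rest w hw
    have hwK : w ∉ K := fun h => hwrest (hKrest h)
    have hwU : w ∈ U := (Finset.mem_sdiff.1 (suns_subset hC₀ hw)).1
    -- The sun of `s₀` is the single vertex `w`; the pair `w, s₀` is absorbed into a cover of `K`.
    -- The induction hypothesis applies to `K` with `s₀` because `w` is missing from it.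
    have hcov := hasCover_pendant hKconn hKsun hKstrict hz hs₀K hwK hsw.symm hzs.symm (by
      intro G' hle hG'
      refine ihU G' hle _ (Finset.card_lt_card ?_) hG'
      rw [Finset.ssubset_iff_of_subset]
      · refine ⟨w, hwU, ?_⟩
        rw [Finset.mem_insert, not_or]
        exact ⟨hsw.ne.symm, hwK⟩
      · exact Finset.insert_subset hs₀U (hKU.trans Finset.sdiff_subset))
    refine hcov.of_sdiff ?_ ?_
    · have h3 : (rest G U S \ K).card < U.card :=
        (Finset.card_le_card Finset.sdiff_subset).trans_lt (hrestlt S hS hS0)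
      have := ihU G le_rfl _ h3 (hrest_good.of_closed Finset.sdiff_subset hKclr.sdiff)
      convert this using 1
      ext y
      simp only [Finset.mem_sdiff, Finset.mem_union, Finset.mem_insert, Finset.mem_singleton]
      grind
    · intro y hy
      simp only [Finset.mem_union, Finset.mem_insert, Finset.mem_singleton] at hy ⊢
      have := @hKrest y
      tauto

end Kaneko

/-! ### From covers to path factors -/

section Factor

variable {V : Type*} [DecidableEq V] {G : SimpleGraph V}

/-- The edges of the listed paths form `F`. For the induction, `F` has no edge at a vertex outside
`U`, and each path is recorded as an injection from `Fin m` whose image is induced and closed under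
adjacency, hence a whole component. -/
theorem HasCover.exists_spanning_paths {U : Finset V} (h : HasCover G U) :
    ∃ F ≤ G, (∀ u v, F.Adj u v → u ∈ U) ∧ ∀ u ∈ U, ∃ m, 3 ≤ m ∧ ∃ φ : Fin m → V,
      Function.Injective φ ∧ (∃ i, φ i = u) ∧ (∀ i, φ i ∈ U) ∧
      (∀ i j, F.Adj (φ i) (φ j) ↔ (SimpleGraph.pathGraph m).Adj i j) ∧
      ∀ i v, F.Adj (φ i) v → ∃ j, φ j = v := by
  induction h with
  | empty => exact ⟨⊥, bot_le, by simp, by simp⟩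
  | @cons U l hc hn h3 hd _ ih =>
    obtain ⟨F, hF, hFU, hFp⟩ := ih
    rw [Finset.disjoint_left] at hd
    have hd : ∀ x ∈ l, x ∉ U := fun x hx => hd (by simpa using hx)
    let e : Fin l.length ↪ V := ⟨l.get, List.nodup_iff_injective_get.1 hn⟩
    have hel : ∀ i, e i ∈ l := fun i => l.get_mem i
    have hadj : ∀ u v, (F ⊔ (SimpleGraph.pathGraph l.length).map e).Adj u v ↔ F.Adj u v ∨
        ∃ i j, (SimpleGraph.pathGraph l.length).Adj i j ∧ e i = u ∧ e j = v := by
      intro u v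
      rw [SimpleGraph.sup_adj, SimpleGraph.map_adj]
    refine ⟨F ⊔ (SimpleGraph.pathGraph l.length).map e, sup_le hF ?_, ?_, ?_⟩
    · intro u v huv
      rw [SimpleGraph.map_adj] at huv
      obtain ⟨i, j, hij, rfl, rfl⟩ := huv
      rw [SimpleGraph.pathGraph_adj] at hij
      rw [List.isChain_iff_getElem] at hc
      have key : ∀ i j : Fin l.length, i.val + 1 = j.val → G.Adj (e i) (e j) := by
        rintro i ⟨j, hj⟩ rfl
        exact hc i.val hj
      rcases hij with hij | hij
      · exact key i j hij
      · exact (key j i hij).symm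
    · intro u v huv
      rw [hadj] at huv
      rcases huv with h | ⟨i, j, -, rfl, -⟩
      · simp [hFU u v h]
      · simp [hel i]
    · intro u hu
      rw [Finset.mem_union, List.mem_toFinset] at hu
      rcases hu with hu | hu
      · refine ⟨l.length, h3, e, e.injective, ?_, ?_, ?_, ?_⟩
        · obtain ⟨i, hi⟩ := List.get_of_mem hu
          exact ⟨i, hi⟩
        · intro i; simp [hel i]
        · intro i j
          rw [hadj]
          constructor
          · rintro (h | ⟨i', j', h, hi, hj⟩)
            · exact absurd (hFU _ _ h) (hd _ (hel i))
            · rw [← e.injective hi, ← e.injective hj]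
              exact h
          · exact fun h => Or.inr ⟨i, j, h, rfl, rfl⟩
        · intro i v h
          rw [hadj] at h
          rcases h with h | ⟨i', j', -, -, rfl⟩
          · exact absurd (hFU _ _ h) (hd _ (hel i))
          · exact ⟨j', rfl⟩
      · obtain ⟨m, hm, φ, h1, h2, h3, h4, h5⟩ := hFp u hu
        have hno : ∀ i v, (F ⊔ (SimpleGraph.pathGraph l.length).map e).Adj (φ i) v →
            F.Adj (φ i) v := by
          intro i v h
          rw [hadj] at h
          rcases h with h | ⟨i', j', -, hi, -⟩
          · exact h
          · exact absurd (h3 i) (hi ▸ hd _ (hel i'))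
        refine ⟨m, hm, φ, h1, h2, fun i => by simp [h3 i], ?_, fun i v h => h5 i v (hno i v h)⟩
        intro i j
        rw [← h4]
        exact ⟨hno i _, fun h => (hadj _ _).2 (Or.inl h)⟩

theorem HasCover.exists_isPathFactor [Fintype V] (h : HasCover G Finset.univ) :
    ∃ F, IsPathFactor G F 3 := by
  obtain ⟨F, hF, -, hp⟩ := h.exists_spanning_paths
  refine ⟨F, hF, fun C => ?_⟩
  obtain ⟨u, hu⟩ := C.nonempty_supp
  obtain ⟨m, hm, φ, hinj, ⟨i₀, rfl⟩, -, hadj, hcl⟩ := hp u (Finset.mem_univ u)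
  obtain ⟨k, rfl⟩ : ∃ k, m = k + 1 := ⟨m - 1, by omega⟩
  refine ⟨k + 1, hm, ⟨RelIso.symm ?_⟩⟩
  let ψ : SimpleGraph.pathGraph (k + 1) →g F := ⟨φ, fun {i j} h => (hadj i j).2 h⟩
  have hmem : ∀ i, φ i ∈ C.supp := by
    intro i
    have hr : F.Reachable (φ i) (φ i₀) :=
      ((SimpleGraph.pathGraph_connected k).preconnected i i₀).map ψ
    rw [SimpleGraph.ConnectedComponent.mem_supp_iff] at hu ⊢
    rw [← hu]
    exact SimpleGraph.ConnectedComponent.sound hr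
  have hsurj : ∀ v ∈ C.supp, ∃ i, φ i = v := by
    intro v hv
    rw [SimpleGraph.ConnectedComponent.mem_supp_iff] at hu hv
    obtain ⟨q⟩ := SimpleGraph.ConnectedComponent.exact (hu.trans hv.symm)
    have : ∀ a b, F.Walk a b → (∃ i, φ i = a) → ∃ i, φ i = b := by
      intro a b q
      induction q with
      | nil => exact id
      | cons hab _ ih =>
        rintro ⟨i, rfl⟩
        exact ih (hcl i _ hab)
    exact this _ _ q ⟨i₀, rfl⟩
  refine ⟨Equiv.ofBijective (fun i => ⟨φ i, hmem i⟩) ⟨?_, ?_⟩, ?_⟩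
  · intro i j hij
    exact hinj (congrArg Subtype.val hij)
  · rintro ⟨v, hv⟩
    obtain ⟨i, rfl⟩ := hsurj v hv
    exact ⟨i, rfl⟩
  · intro i j
    exact hadj i j

end Factor

/-! ### Toughness and connectivity imply Kaneko's condition -/

section Application

variable {V : Type*} [Fintype V] [DecidableEq V] {G : SimpleGraph V}

theorem numComponents_deleteVerts (G : SimpleGraph V) (X : Finset V) :
    numComponents (deleteVerts G X) = (comps G Xᶜ).card := by
  classical
  obtain ⟨Φ, -⟩ := exists_component_equiv (G := G) (deleteVerts G X) Subtype.val
    Subtype.val_injective (fun _ _ => Iff.rfl) Xᶜ (fun x => by simp)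
  rw [numComponents, Nat.card_congr Φ]
  simp

theorem conn_compl_of_connected {X : Finset V} (h : (deleteVerts G X).Connected) :
    Conn G Xᶜ := by
  have h1 : (comps G Xᶜ).card = 1 := by
    rw [← numComponents_deleteVerts, numComponents, Nat.card_eq_one_iff_unique]
    have := h.preconnected.subsingleton_connectedComponent
    have := h.nonempty
    exact ⟨inferInstance, inferInstance⟩
  obtain ⟨C, hC⟩ := Finset.card_eq_one.1 h1
  have h2 := biUnion_comps (G := G) Xᶜ
  rw [hC, Finset.singleton_biUnion, id] at h2
  have h3 : C ∈ comps G Xᶜ := by rw [hC]; simp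
  rw [← h2]
  exact (mem_comps.1 h3).2.1

theorem card_comps_of_conn {U : Finset V} (h : Conn G U) : (comps G U).card ≤ 1 :=
  (Finset.card_le_card (comps_of_conn h)).trans (by simp)

theorem deleteEdge_adj {x y a b : V} :
    (G.deleteEdges {s(x, y)}).Adj a b ↔ G.Adj a b ∧ s(a, b) ≠ s(x, y) := by
  rw [SimpleGraph.deleteEdges_adj]
  simp

/-- Components avoiding both ends of the edge are old, and the old component of `x` is not among
them; at most two new ones replace it. -/
theorem card_comps_deleteEdge_le (x y : V) (A : Finset V) :
    (comps (G.deleteEdges {s(x, y)}) A).card ≤ (comps G A).card + 1 := by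
  set H := G.deleteEdges {s(x, y)} with hH
  by_cases hxy : x ∈ A ∧ y ∈ A
  · obtain ⟨Cx, hCx, hxCx⟩ := exists_mem_comps (G := G) hxy.1
    have hsub : comps H A ⊆ (comps G A).erase Cx ∪
        ((comps H A).filter (fun C => x ∈ C) ∪ (comps H A).filter (fun C => y ∈ C)) := by
      intro C hC
      simp only [Finset.mem_union, Finset.mem_filter, Finset.mem_erase]
      by_cases hxC : x ∈ C
      · tauto
      by_cases hyC : y ∈ C
      · tauto
      refine Or.inl ⟨?_, comps_congr hC fun u hu w _ => ?_⟩
      · rintro rfl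
        exact hxC hxCx
      rw [hH, deleteEdge_adj]
      refine ⟨fun h => h.1, fun h => ⟨h, fun he => ?_⟩⟩
      rw [Sym2.eq_iff] at he
      rcases he with ⟨h, -⟩ | ⟨h, -⟩
      · exact hxC (h ▸ hu)
      · exact hyC (h ▸ hu)
    have hone : ∀ v, ((comps H A).filter (fun C => v ∈ C)).card ≤ 1 := by
      intro v
      rw [Finset.card_le_one]
      intro C hC D hD
      rw [Finset.mem_filter] at hC hD
      exact comps_eq hC.1 hD.1 hC.2 hD.2
    have h2 := Finset.card_le_card hsub
    have h3 := Finset.card_union_le ((comps G A).erase Cx)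
      ((comps H A).filter (fun C => x ∈ C) ∪ (comps H A).filter (fun C => y ∈ C))
    have h4 := Finset.card_union_le ((comps H A).filter (fun C => x ∈ C))
      ((comps H A).filter (fun C => y ∈ C))
    have h5 := Finset.card_erase_add_one hCx
    have := hone x
    have := hone y
    omega
  · refine (Finset.card_le_card fun C hC => comps_congr hC fun u hu w hw => ?_).trans (Nat.le_succ _)
    rw [hH, deleteEdge_adj]
    refine ⟨fun h => h.1, fun h => ⟨h, fun he => hxy ?_⟩⟩
    have huA := (mem_comps.1 hC).1 hu
    rw [Sym2.eq_iff] at he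
    rcases he with ⟨rfl, rfl⟩ | ⟨rfl, rfl⟩
    · exact ⟨huA, hw⟩
    · exact ⟨hw, huA⟩

/-- Deleting an edge from a graph that stays connected after the removal of any vertex does not
create a sun component. -/
theorem suns_deleteEdge_eq_empty {U : Finset V} (h3 : 3 ≤ U.card) (hU : Conn G U)
    (hU' : ∀ v ∈ U, Conn G (U.erase v)) (x y : V) :
    suns (G.deleteEdges {s(x, y)}) U = ∅ := by
  rw [Finset.eq_empty_iff_forall_notMem]
  intro C hC
  have hsub := suns_subset hC
  have hcl := suns_closed hC
  by_cases hCU : C = U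
  -- A pendant vertex off the deleted edge is pendant in the original graph too, so its neighbour
  -- would be a cut vertex.
  · subst hCU
    obtain ⟨l, hl, m, hm, hlx, hly, hlm, hleaf⟩ := (suns_isSun hC).exists_leaf h3 x y
    have h1 := (hU' m hm).2 {l} (by simp [hl, hlm]) (by simp) (by
      intro a ha b hb hab
      obtain rfl : a = l := by simpa using ha
      rw [Finset.mem_erase] at hb
      refine absurd (hleaf b hb.2 (deleteEdge_adj.2 ⟨hab, ?_⟩)) hb.1
      rw [Ne, Sym2.eq_iff]
      tauto)
    have h2 := Finset.card_erase_add_one hm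
    rw [← h1, Finset.card_singleton] at h2
    omega
  -- The deleted edge is a bridge `ab`. As neither end is a cut vertex, each side of the bridge is a
  -- single vertex, contradicting `|U| ≥ 3`.
  · obtain ⟨a, ha, b, hb, hbC, hab⟩ := hU.exists_adj hsub (suns_nonempty hC) hCU
    have hedge : s(a, b) = s(x, y) := by
      by_contra hne
      exact hbC (hcl a ha b hb (deleteEdge_adj.2 ⟨hab, hne⟩))
    have hCa : C ⊆ {a} := by
      by_contra hnot
      have hne : (C.erase a).Nonempty := by
        rw [Finset.nonempty_iff_ne_empty, Ne, Finset.erase_eq_empty_iff]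
        rintro (rfl | rfl)
        · simp at ha
        · simp at hnot
      have := (hU' a (hsub ha)).2 (C.erase a) (Finset.erase_subset_erase a hsub) hne (by
        intro u hu w hw huw
        rw [Finset.mem_erase] at hu hw ⊢
        refine ⟨hw.1, hcl u hu.2 w hw.2 (deleteEdge_adj.2 ⟨huw, fun he => ?_⟩)⟩
        rw [← hedge, Sym2.eq_iff] at he
        tauto)
      have hbm : b ∈ U.erase a := by simp [hb, hab.ne.symm]
      rw [← this] at hbm
      exact hbC (Finset.mem_of_mem_erase hbm)
    have hDb : U \ C ⊆ {b} := by
      by_contra hnot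
      have hne : ((U \ C).erase b).Nonempty := by
        rw [Finset.nonempty_iff_ne_empty, Ne, Finset.erase_eq_empty_iff]
        rintro (h | h)
        · have : b ∈ U \ C := by simp [hb, hbC]
          rw [h] at this
          simp at this
        · simp [h] at hnot
      have := (hU' b hb).2 ((U \ C).erase b)
        (Finset.erase_subset_erase b Finset.sdiff_subset) hne (by
        intro u hu w hw huw
        rw [Finset.mem_erase] at hu hw ⊢
        refine ⟨hw.1, hcl.sdiff u hu.2 w hw.2 (deleteEdge_adj.2 ⟨huw, fun he => ?_⟩)⟩
        have huC := (Finset.mem_sdiff.1 hu.2).2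
        rw [← hedge, Sym2.eq_iff] at he
        rcases he with ⟨rfl, -⟩ | ⟨h, -⟩
        · exact huC ha
        · exact hu.1 h)
      have ham : a ∈ U.erase b := by simp [hsub ha, hab.ne]
      rw [← this] at ham
      exact (Finset.mem_sdiff.1 (Finset.mem_of_mem_erase ham)).2 ha
    have h4 := Finset.card_le_card hCa
    have h5 := Finset.card_le_card hDb
    have h6 := Finset.card_sdiff_add_card_eq_card hsub
    simp only [Finset.card_singleton] at h4 h5
    omega

theorem natCast_div_le {a b c d : ℕ} (hb : b ≠ 0) (hd : d ≠ 0) (h : a * d ≤ c * b) :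
    (a : ℝ≥0∞) / b ≤ (c : ℝ≥0∞) / d := by
  rw [ENNReal.div_le_iff (by simpa using hb) (by simp), ← ENNReal.mul_div_right_comm,
    ENNReal.le_div_iff_mul_le (Or.inl (by simpa using hd)) (Or.inl (by simp))]
  exact_mod_cast h

theorem natCast_div_lt {a b c d : ℕ} (hb : b ≠ 0) (hd : d ≠ 0) (h : a * d < c * b) :
    (a : ℝ≥0∞) / b < (c : ℝ≥0∞) / d := by
  rw [ENNReal.div_lt_iff (Or.inl (by simpa using hb)) (Or.inl (by simp)),
    ← ENNReal.mul_div_right_comm,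
    ENNReal.lt_div_iff_mul_lt (Or.inl (by simpa using hd)) (Or.inl (by simp))]
  exact_mod_cast h

/-- Kaneko's criterion is verified for `G - W - e`; the resulting factor avoids `e` because its
edges lie in the graph without `e`. -/
theorem isPathFactorCriticalAvoidable_of_toughness (n r : ℕ)
    (hc : IsVertexConnected G (n + r + 2))
    (ht : ((n : ℝ≥0∞) + r + 2) / (2 * ((r : ℝ≥0∞) + 2)) < toughness G) :
    IsPathFactorCriticalAvoidable G 3 n := by
  classical
  intro W hW e he
  induction e using Sym2.ind with
  | _ x y =>
  set H := G.deleteEdges {s(x.1, y.1)} with hH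
  have hconn : ∀ X : Finset V, X.card < n + r + 2 → Conn G Xᶜ := fun X hX =>
    conn_compl_of_connected (hc.2 X hX)
  have hgood : Good H Wᶜ := by
    intro S hS
    rcases S.eq_empty_or_nonempty with rfl | hS0
    · rw [Finset.sdiff_empty, hH, suns_deleteEdge_eq_empty]
      · simp
      · have := hc.1
        rw [Finset.card_compl, hW]
        omega
      · exact hconn W (by omega)
      · intro v hv
        have : Wᶜ.erase v = (insert v W)ᶜ := by
          ext; simp
        rw [this]
        refine hconn _ ?_
        have := Finset.card_insert_le v W
        omega
    · by_contra hlt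
      have hS1 := hS0.card_pos
      have h1 : (suns H (Wᶜ \ S)).card ≤ (comps G (Wᶜ \ S)).card + 1 :=
        (Finset.card_le_card suns_subset_comps).trans (card_comps_deleteEdge_le _ _ _)
      have e1 : Wᶜ \ S = (W ∪ S)ᶜ := by
        ext; simp
      have hcard : (W ∪ S).card = n + S.card := by
        rw [Finset.card_union_of_disjoint, hW]
        rw [Finset.disjoint_right]
        intro a ha
        simpa using hS ha
      rw [e1] at h1 hlt
      set k := (comps G (W ∪ S)ᶜ).card with hk
      have hk2 : 2 * S.card ≤ k := by omega
      -- With fewer vertices, `W ∪ S` would be too small to disconnect `G`, leaving at most one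
      -- component instead of `2|S| ≥ 2`.
      have hSr : r + 2 ≤ S.card := by
        by_contra hcon
        have := card_comps_of_conn (hconn (W ∪ S) (by omega))
        omega
      have hnum : numComponents (deleteVerts G (W ∪ S)) = k := numComponents_deleteVerts G _
      have hle : toughness G ≤ ((W ∪ S).card : ℝ≥0∞) / (k : ℝ≥0∞) := by
        rw [← hnum]
        exact iInf₂_le (W ∪ S) (by omega)
      -- The ratio is at most `(n + |S|) / (2|S|)`, which decreases in `|S|` and so is largest at
      -- `|S| = r + 2`.
      refine absurd (ht.trans_le hle) (not_lt.2 ?_)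
      have := natCast_div_le (a := (W ∪ S).card) (b := k) (c := n + r + 2) (d := 2 * (r + 2))
        (by omega) (by omega) (by rw [hcard]; nlinarith)
      push_cast at this
      exact this
  have hcov := (hasCover_of_good H Wᶜ hgood).restrict
    (Subtype.val : ((W : Set V)ᶜ : Set V) → V) Subtype.val_injective (fun v hv => by simpa using hv)
  have hu : (Wᶜ : Finset V).preimage (Subtype.val : ((W : Set V)ᶜ : Set V) → V)
      Subtype.val_injective.injOn = Finset.univ := by
    ext v
    have : v.1 ∉ (W : Set V) := v.2
    simpa using this
  rw [hu] at hcov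
  obtain ⟨F, hF, hF'⟩ := hcov.exists_isPathFactor
  refine ⟨F, ⟨fun a b hab => ?_, hF'⟩, fun hxy => ?_⟩
  · exact (deleteEdge_adj.1 (hF hab)).1
  · exact (deleteEdge_adj.1 (hF hxy)).2 rfl

end Application

/-! ### The extremal graphs -/

section Extremal

theorem extremalGraph_adj_inl {a b : ℕ} {i : Fin a} {v : Fin a ⊕ (Fin b ⊕ Fin 2)} :
    (extremalGraph a b).Adj (Sum.inl i) v ↔ v ≠ Sum.inl i := by
  rcases v with j | v
  · simp [extremalGraph, join, eq_comm]
  · simp [extremalGraph, join]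

theorem extremalGraph_adj_inr {a b : ℕ} {u v : Fin b ⊕ Fin 2} :
    (extremalGraph a b).Adj (Sum.inr u) (Sum.inr v) ↔
      ∃ i j : Fin 2, i ≠ j ∧ u = Sum.inr i ∧ v = Sum.inr j := by
  rcases u with u | u <;> rcases v with v | v <;> simp [extremalGraph, join]

theorem extremalGraph_deleteVerts_connected {a b : ℕ} {X : Finset (Fin a ⊕ (Fin b ⊕ Fin 2))}
    {i : Fin a} (hi : Sum.inl i ∉ X) : (deleteVerts (extremalGraph a b) X).Connected := by
  let c : ((X : Set (Fin a ⊕ (Fin b ⊕ Fin 2)))ᶜ : Set _) := ⟨Sum.inl i, by simpa using hi⟩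
  rw [SimpleGraph.connected_iff_exists_forall_reachable]
  refine ⟨c, fun v => ?_⟩
  by_cases hv : v = c
  · rw [hv]
  · refine SimpleGraph.Adj.reachable ?_
    show (extremalGraph a b).Adj (Sum.inl i) v.1
    rw [extremalGraph_adj_inl]
    exact fun h => hv (Subtype.ext h)

theorem card_le_of_forall_inl_mem {a b : ℕ} {X : Finset (Fin a ⊕ (Fin b ⊕ Fin 2))}
    (h : ∀ i : Fin a, Sum.inl i ∈ X) : a ≤ X.card := by
  classical
  have : (Finset.univ.image (Sum.inl : Fin a → Fin a ⊕ (Fin b ⊕ Fin 2))) ⊆ X := by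
    intro x hx
    obtain ⟨i, -, rfl⟩ := Finset.mem_image.1 hx
    exact h i
  have := Finset.card_le_card this
  rwa [Finset.card_image_of_injective _ Sum.inl_injective, Finset.card_univ, Fintype.card_fin] at this

theorem extremalGraph_isVertexConnected (a b : ℕ) : IsVertexConnected (extremalGraph a b) a := by
  refine ⟨by simp, fun X hX => ?_⟩
  have : ∃ i : Fin a, Sum.inl i ∉ X := by
    by_contra hcon
    push Not at hcon
    exact absurd (card_le_of_forall_inl_mem hcon) (by omega)
  obtain ⟨i, hi⟩ := this
  exact extremalGraph_deleteVerts_connected hi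

/-- The label of the component of a vertex after the removal of the complete part. -/
def extremalLabel {a b : ℕ} : Fin a ⊕ (Fin b ⊕ Fin 2) → Option (Fin b)
  | Sum.inr (Sum.inl j) => some j
  | _ => none

/-- Once the complete part is gone, the label is constant along edges and separates components;
`none` marks the `K₂`. -/
theorem exists_component_label {a b : ℕ} {X : Finset (Fin a ⊕ (Fin b ⊕ Fin 2))}
    (h : ∀ i : Fin a, Sum.inl i ∈ X) :
    ∃ f : (deleteVerts (extremalGraph a b) X).ConnectedComponent → Option (Fin b),
      Function.Injective f ∧
      ∀ v, f ((deleteVerts (extremalGraph a b) X).connectedComponentMk v) = extremalLabel v.1 := by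
  set K := deleteVerts (extremalGraph a b) X with hK
  have hinr : ∀ v : ((X : Set (Fin a ⊕ (Fin b ⊕ Fin 2)))ᶜ : Set _), ∃ u, v.1 = Sum.inr u := by
    rintro ⟨v | v, hv⟩
    · exact absurd (h v) (by simpa using hv)
    · exact ⟨v, rfl⟩
  have hadj : ∀ v w, K.Adj v w → extremalLabel v.1 = extremalLabel w.1 := by
    intro v w hvw
    obtain ⟨u, hu⟩ := hinr v
    obtain ⟨u', hu'⟩ := hinr w
    have hvw : (extremalGraph a b).Adj v.1 w.1 := hvw
    rw [hu, hu', extremalGraph_adj_inr] at hvw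
    obtain ⟨i, j, -, rfl, rfl⟩ := hvw
    rw [hu, hu']
    rfl
  have hwalk : ∀ v w, K.Walk v w → extremalLabel v.1 = extremalLabel w.1 := by
    intro v w p
    induction p with
    | nil => rfl
    | cons hvw _ ih => exact (hadj _ _ hvw).trans ih
  refine ⟨SimpleGraph.ConnectedComponent.lift (fun v => extremalLabel v.1)
    (fun v w p _ => hwalk v w p), ?_, fun v => rfl⟩
  intro c d
  refine SimpleGraph.ConnectedComponent.ind₂ (fun v w hvw => ?_) c d
  have hvw : extremalLabel v.1 = extremalLabel w.1 := hvw
  refine SimpleGraph.ConnectedComponent.sound ?_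
  by_cases hne : v = w
  · rw [hne]
  obtain ⟨u, hu⟩ := hinr v
  obtain ⟨u', hu'⟩ := hinr w
  have hne' : v.1 ≠ w.1 := fun h => hne (Subtype.ext h)
  rw [hu, hu'] at hvw hne'
  have : K.Adj v w := by
    show (extremalGraph a b).Adj v.1 w.1
    rw [hu, hu', extremalGraph_adj_inr]
    rcases u with u | u <;> rcases u' with u' | u' <;> simp [extremalLabel] at hvw hne' ⊢
    · exact hne' hvw
    · exact hne'
  exact this.reachable

/-- A surviving vertex of the complete part is adjacent to everything, so a disconnecting set
contains that part. Removing exactly it minimises the numerator and maximises the number of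
components, `b + 1`. -/
theorem toughness_extremalGraph (a b : ℕ) (hb : 1 ≤ b) :
    toughness (extremalGraph a b) = (a : ℝ≥0∞) / ((b : ℝ≥0∞) + 1) := by
  classical
  apply le_antisymm
  · set X : Finset (Fin a ⊕ (Fin b ⊕ Fin 2)) := Finset.univ.image Sum.inl with hX
    obtain ⟨f, hf, hfv⟩ := exists_component_label (X := X) (fun i => by simp [hX])
    have hsurj : Function.Surjective f := by
      intro o
      have hmem : ∀ u : Fin b ⊕ Fin 2, (Sum.inr u : Fin a ⊕ (Fin b ⊕ Fin 2)) ∈ (X : Set _)ᶜ := by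
        intro u; simp [hX]
      rcases o with _ | j
      · exact ⟨_, hfv ⟨Sum.inr (Sum.inr 0), hmem _⟩⟩
      · exact ⟨_, hfv ⟨Sum.inr (Sum.inl j), hmem _⟩⟩
    have hnum : numComponents (deleteVerts (extremalGraph a b) X) = b + 1 := by
      rw [numComponents, Nat.card_congr (Equiv.ofBijective f ⟨hf, hsurj⟩)]
      simp
    have hXa : X.card = a := by
      rw [hX, Finset.card_image_of_injective _ Sum.inl_injective]
      simp
    refine (iInf₂_le X (by omega)).trans (le_of_eq ?_)
    rw [hnum, hXa]
    push_cast
    rfl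
  · refine le_iInf₂ fun X hX => ?_
    have hall : ∀ i : Fin a, Sum.inl i ∈ X := by
      intro i
      by_contra hi
      have hconn := extremalGraph_deleteVerts_connected (b := b) hi
      have := hconn.preconnected.subsingleton_connectedComponent
      have : numComponents (deleteVerts (extremalGraph a b) X) ≤ 1 :=
        Finite.card_le_one_iff_subsingleton.2 inferInstance
      omega
    obtain ⟨f, hf, -⟩ := exists_component_label hall
    have hnum : numComponents (deleteVerts (extremalGraph a b) X) ≤ b + 1 := by
      have := Nat.card_le_card_of_injective f hf
      simpa [numComponents] using this
    refine ENNReal.div_le_div ?_ ?_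
    · exact_mod_cast card_le_of_forall_inl_mem hall
    · exact_mod_cast hnum

theorem IsPathFactor.exists_adj {V : Type*} {G F : SimpleGraph V} (h : IsPathFactor G F 3) (v : V) :
    ∃ w, F.Adj v w := by
  obtain ⟨m, hm, ⟨φ⟩⟩ := h.2 (F.connectedComponentMk v)
  set v' : F.connectedComponentMk v := ⟨v, rfl⟩
  have : ∃ j, (SimpleGraph.pathGraph m).Adj (φ v') j := by
    by_cases h0 : (φ v').val = 0
    · exact ⟨⟨1, by omega⟩, by rw [SimpleGraph.pathGraph_adj]; simp [h0]⟩
    · exact ⟨⟨(φ v').val - 1, by omega⟩, by rw [SimpleGraph.pathGraph_adj]; simp; omega⟩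
  obtain ⟨j, hj⟩ := this
  refine ⟨(φ.symm j).1, ?_⟩
  have : (F.connectedComponentMk v).toSimpleGraph.Adj v' (φ.symm j) := by
    rw [← φ.map_adj_iff]
    simpa using hj
  exact this

theorem IsPathFactor.adj_eq {V : Type*} {G F : SimpleGraph V} {k : ℕ} (h : IsPathFactor G F k)
    {v w₁ w₂ w₃ : V} (h₁ : F.Adj v w₁) (h₂ : F.Adj v w₂) (h₃ : F.Adj v w₃) :
    w₁ = w₂ ∨ w₁ = w₃ ∨ w₂ = w₃ := by
  obtain ⟨m, -, ⟨φ⟩⟩ := h.2 (F.connectedComponentMk v)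
  set C := F.connectedComponentMk v with hC
  have hmem : ∀ w, F.Adj v w → w ∈ C := fun w hw =>
    SimpleGraph.ConnectedComponent.sound hw.symm.reachable
  have hadj : ∀ w (hw : F.Adj v w),
      (φ ⟨v, rfl⟩).val + 1 = (φ ⟨w, hmem w hw⟩).val ∨
      (φ ⟨w, hmem w hw⟩).val + 1 = (φ ⟨v, rfl⟩).val := by
    intro w hw
    rw [← SimpleGraph.pathGraph_adj, φ.map_adj_iff]
    exact hw
  have hinj : ∀ w w' (hw : F.Adj v w) (hw' : F.Adj v w'),
      (φ ⟨w, hmem w hw⟩).val = (φ ⟨w', hmem w' hw'⟩).val → w = w' := by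
    intro w w' hw hw' he
    exact congrArg Subtype.val (φ.injective (Fin.ext he))
  have a₁ := hadj w₁ h₁
  have a₂ := hadj w₂ h₂
  have a₃ := hadj w₃ h₃
  by_contra hcon
  push Not at hcon
  have n₁ := mt (hinj _ _ h₁ h₂) hcon.1
  have n₂ := mt (hinj _ _ h₁ h₃) hcon.2.1
  have n₃ := mt (hinj _ _ h₂ h₃) hcon.2.2
  omega

/-- Remove `n` vertices of the complete part and forbid the `K₂` edge. Each of the `b + 2` other
vertices then has a factor neighbour among the `a - n` remaining ones, so by pigeonhole one of these
has degree three, impossible in a path. -/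
theorem extremalGraph_not_avoidable {a b n : ℕ} (hn : n ≤ a) (h : 2 * (a - n) < b + 2) :
    ¬ IsPathFactorCriticalAvoidable (extremalGraph a b) 3 n := by
  classical
  intro hav
  set W : Finset (Fin a ⊕ (Fin b ⊕ Fin 2)) :=
    (Finset.univ.image (Fin.castLE hn)).image Sum.inl with hWdef
  have hW : W.card = n := by
    rw [hWdef, Finset.card_image_of_injective _ Sum.inl_injective,
      Finset.card_image_of_injective _ (Fin.castLE_injective hn)]
    simp
  have hmem : ∀ u : Fin b ⊕ Fin 2, (Sum.inr u : Fin a ⊕ (Fin b ⊕ Fin 2)) ∈ (W : Set _)ᶜ := by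
    intro u; simp [hWdef]
  let ι : Fin b ⊕ Fin 2 → ((W : Set (Fin a ⊕ (Fin b ⊕ Fin 2)))ᶜ : Set _) :=
    fun u => ⟨Sum.inr u, hmem u⟩
  have he : s(ι (Sum.inr 0), ι (Sum.inr 1)) ∈ (deleteVerts (extremalGraph a b) W).edgeSet := by
    show (extremalGraph a b).Adj (Sum.inr (Sum.inr 0)) (Sum.inr (Sum.inr 1))
    rw [extremalGraph_adj_inr]
    exact ⟨0, 1, by decide, rfl, rfl⟩
  obtain ⟨F, hF, heF⟩ := hav W hW _ he
  have hnbr : ∀ u, ∃ i : Fin a, ∃ hi : Sum.inl i ∈ (W : Set (Fin a ⊕ (Fin b ⊕ Fin 2)))ᶜ,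
      F.Adj ⟨Sum.inl i, hi⟩ (ι u) := by
    intro u
    obtain ⟨⟨w | w, hw⟩, huw⟩ := hF.exists_adj (ι u)
    · exact ⟨w, hw, huw.symm⟩
    · exfalso
      have h1 : (extremalGraph a b).Adj (Sum.inr u) (Sum.inr w) := hF.1 huw
      rw [extremalGraph_adj_inr] at h1
      obtain ⟨i, j, hij, rfl, rfl⟩ := h1
      refine heF ?_
      have : (i = 0 ∧ j = 1) ∨ (i = 1 ∧ j = 0) := by omega
      rcases this with ⟨rfl, rfl⟩ | ⟨rfl, rfl⟩
      · exact huw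
      · exact huw.symm
  choose f hfW hfadj using hnbr
  obtain ⟨y, -, hy⟩ := Finset.exists_lt_card_fiber_of_mul_lt_card_of_maps_to
    (s := (Finset.univ : Finset (Fin b ⊕ Fin 2))) (t := (Finset.univ.image (Fin.castLE hn))ᶜ)
    (f := f) (n := 2) (by
      intro u _
      rw [Finset.mem_compl]
      intro hu
      refine hfW u ?_
      rw [hWdef, Finset.mem_coe]
      exact Finset.mem_image_of_mem _ hu) (by
      rw [Finset.card_compl, Finset.card_image_of_injective _ (Fin.castLE_injective hn)]
      simp
      omega)
  obtain ⟨u₁, h₁, u₂, h₂, u₃, h₃, n₁, n₂, n₃⟩ := Finset.two_lt_card.1 hy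
  simp only [Finset.mem_filter, Finset.mem_univ, true_and] at h₁ h₂ h₃
  subst h₁
  have k₂ : F.Adj ⟨Sum.inl (f u₁), hfW u₁⟩ (ι u₂) := by
    have := hfadj u₂
    simp only [h₂] at this
    exact this
  have k₃ : F.Adj ⟨Sum.inl (f u₁), hfW u₁⟩ (ι u₃) := by
    have := hfadj u₃
    simp only [h₃] at this
    exact this
  have hι : Function.Injective ι := fun u v huv =>
    Sum.inr_injective (congrArg Subtype.val huv)
  rcases hF.adj_eq (hfadj u₁) k₂ k₃ with h | h | h
  · exact n₁ (hι h)
  · exact n₂ (hι h)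
  · exact n₃ (hι h)

end Extremal

end PathFactor

/-- The first conjunct is the sufficient condition, the second the sharpness of the toughness
bound, the third the sharpness of the connectivity assumption. -/
theorem theorem7 (n r : ℕ) :
    (∀ (V : Type*) [Fintype V] (G : SimpleGraph V),
      PathFactor.IsVertexConnected G (n + r + 2) →
      ((n : ℝ≥0∞) + r + 2) / (2 * ((r : ℝ≥0∞) + 2)) < PathFactor.toughness G →
      PathFactor.IsPathFactorCriticalAvoidable G 3 n) ∧
    (PathFactor.IsVertexConnected
        (PathFactor.extremalGraph (n + r + 2) (2 * r + 3)) (n + r + 2) ∧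
      PathFactor.toughness (PathFactor.extremalGraph (n + r + 2) (2 * r + 3)) =
        ((n : ℝ≥0∞) + r + 2) / (2 * ((r : ℝ≥0∞) + 2)) ∧
      ¬ PathFactor.IsPathFactorCriticalAvoidable
        (PathFactor.extremalGraph (n + r + 2) (2 * r + 3)) 3 n) ∧
    (1 ≤ n →
      PathFactor.IsVertexConnected
        (PathFactor.extremalGraph (n + r + 1) (2 * r + 1)) (n + r + 1) ∧
      PathFactor.toughness (PathFactor.extremalGraph (n + r + 1) (2 * r + 1)) =
        ((n : ℝ≥0∞) + r + 1) / (2 * (r : ℝ≥0∞) + 2) ∧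
      ((n : ℝ≥0∞) + r + 2) / (2 * ((r : ℝ≥0∞) + 2)) <
        PathFactor.toughness (PathFactor.extremalGraph (n + r + 1) (2 * r + 1)) ∧
      ¬ PathFactor.IsPathFactorCriticalAvoidable
        (PathFactor.extremalGraph (n + r + 1) (2 * r + 1)) 3 n) := by
  refine ⟨fun V _ G hc ht => ?_, ⟨?_, ?_, ?_⟩, fun hn => ⟨?_, ?_, ?_, ?_⟩⟩
  · classical
    exact PathFactor.isPathFactorCriticalAvoidable_of_toughness n r hc ht
  · exact PathFactor.extremalGraph_isVertexConnected _ _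
  · rw [PathFactor.toughness_extremalGraph _ _ (by omega)]
    push_cast
    congr 1
    ring
  · exact PathFactor.extremalGraph_not_avoidable (by omega) (by omega)
  · exact PathFactor.extremalGraph_isVertexConnected _ _
  · rw [PathFactor.toughness_extremalGraph _ _ (by omega)]
    push_cast
    congr 1
    ring
  · rw [PathFactor.toughness_extremalGraph _ _ (by omega)]
    -- After cross-multiplication the two sides differ by exactly `2n`; this is where `n ≥ 1` is
    -- needed.
    have h := PathFactor.natCast_div_lt (a := n + r + 2) (b := 2 * (r + 2)) (c := n + r + 1)
      (d := 2 * r + 1 + 1) (by omega) (by omega) (by nlinarith)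
    push_cast at h ⊢
    exact h
  · exact PathFactor.extremalGraph_not_avoidable (by omega) (by omega)
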